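/- \textbf{Theorem.} Let $M$ be the monoid defined by the presentation \begin{align*} \langle\, a, a^{-1}, b, b^{-1}, h, z \;|\;& aa^{-1} = a^{-1}a = bb^{-1} = b^{-1}b = 1,\\ & xh = hx,\ hxy = hyx \quad (x,y \in \{a,a^{-1},b,b^{-1}\}),\\ & h^2a = h^2a^{-1} = h^2b = h^2b^{-1} = h^3 = h^2,\ h^2 = z \,\rangle \end{align*} and let $N$ be the monoid defined by the presentation \begin{align*} \langle\, a, a^{-1}, b, b^{-1}, h, z \;|\;& aa^{-1} = a^{-1}a = bb^{-1} = b^{-1}b = 1,\\ & xh = hx,\ hxy = hyx \quad (x,y \in \{a,a^{-1},b,b^{-1}\}),\\ & zu = uz = z \quad (u \in \{a,a^{-1},b,b^{-1},h,z\}),\ h^2 = h \,\rangle . \end{align*} Let $A = \{a,a^{-1},b,b^{-1},h,z\}$, and for a monoid $S$ generated by (the images of the letters of) a finite set $A$ let $d_A$ be the directed semimetric $d_A(x,y) = \inf\{|w| : w \in A^*,\ xw = y\} \in \{0,1,2,\dots\}\cup\{\infty\}$. Then: \begin{enumerate} \item $(M,d_A)$ and $(N,d_A)$ are isometric, i.e.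 there is a bijection $f : M \to N$ with $d_A(f(x),f(y)) = d_A(x,y)$ for all $x,y \in M$; \item $M$ does not have finite derivation type (FDT) and is not presentable by a finite complete (noetherian and confluent) rewriting system; \item $N$ is presentable by a finite complete rewriting system, and $N$ has FDT. \end{enumerate} Consequently neither FDT nor presentability by a finite complete rewriting system is an isometry invariant of finitely generated monoids: neither property is determined by the isometry class of the semimetric space $(S,d_A)$ for a finite generating set $A$. Here, for a presentation $\langle A \,|\, R\rangle$, the derivation graph $\Gamma$ has vertex set $A^*$ and edges $(w_1,r,\varepsilon,w_2)$ with $w_1,w_2\in A^*$, $r=(r_{+1},r_{-1})\in R$, $\varepsilon=\pm1$, going from $w_1r_{\varepsilon}w_2$ to $w_1r_{-\varepsilon}w_2$, with inverse $(w_1,r,-\varepsilon,w_2)$; $A^*$ acts on both sides by $x\cdot(w_1,r,\varepsilon,w_2)\cdot y=(xw_1,r,\varepsilon,w_2y)$, and so on paths. Write $\iota$, $\tau$ for initial and terminal vertices. A homotopy relation is an equivalence relation $\sim$ on paths that relates only paths with the same ends and satisfies: (H1) $(e_1\cdot\iota e_2)\circ(\tau e_1\cdot e_2)\sim(\iota e_1\cdot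 e_2)\circ(e_1\cdot\tau e_2)$ for all edges $e_1,e_2$; (H2) it is invariant under the two-sided action of $A^*$; (H3) it is invariant under composition of paths on either side; (H4) $p\circ p^{-1}$ is equivalent to the empty path at $\iota p$ for every path $p$. A set $C$ of pairs of parallel paths (paths with the same ends) is a homotopy base if the smallest homotopy relation containing $C$ relates any two parallel paths. The presentation has FDT if $\Gamma$ has a finite homotopy base, and a monoid has FDT if it is defined by some finite presentation that has FDT. -/

import Mathlib

open scoped ENNReal

/-! ## Rewriting systems and finite complete presentations

A rewriting system (monoid presentation) over an alphabet `A` is a relation `rels` on the free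
monoid `A*`; `rels u v` says that `u = v` (read as `u → v`) is one of its rules.  The monoid it
defines is `PresentedMonoid rels`. -/

namespace MonoidRewriting

universe u

variable {A : Type u}

/-- The rewriting system has finitely many rules. -/
def FiniteRules (rels : FreeMonoid A → FreeMonoid A → Prop) : Prop :=
  {r : FreeMonoid A × FreeMonoid A | rels r.1 r.2}.Finite

/-- The single-step reduction relation `u →_R v`. -/
def Step (rels : FreeMonoid A → FreeMonoid A → Prop) (u v : FreeMonoid A) : Prop :=
  ∃ w₁ l r w₂ : FreeMonoid A, rels l r ∧ u = w₁ * l * w₂ ∧ v = w₁ * r * w₂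

/-- There are no infinite reduction sequences. -/
def IsNoetherian (rels : FreeMonoid A → FreeMonoid A → Prop) : Prop :=
  ¬ ∃ f : ℕ → FreeMonoid A, ∀ n, Step rels (f n) (f (n + 1))

/-- Any two descendants of a word have a common descendant. -/
def IsConfluent (rels : FreeMonoid A → FreeMonoid A → Prop) : Prop :=
  ∀ w u v : FreeMonoid A,
    Relation.ReflTransGen (Step rels) w u → Relation.ReflTransGen (Step rels) w v →
      ∃ t, Relation.ReflTransGen (Step rels) u t ∧ Relation.ReflTransGen (Step rels) v t

/-- A complete (convergent) rewriting system: noetherian and confluent. -/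
def IsComplete (rels : FreeMonoid A → FreeMonoid A → Prop) : Prop :=
  IsNoetherian rels ∧ IsConfluent rels

/-- The monoid `S` is presentable by a finite complete rewriting system. -/
def HasFiniteCompletePresentation (S : Type*) [Monoid S] : Prop :=
  ∃ (A : Type) (rels : FreeMonoid A → FreeMonoid A → Prop),
    Finite A ∧ FiniteRules rels ∧ IsComplete rels ∧ Nonempty (S ≃* PresentedMonoid rels)

/-! ## Derivation graphs, homotopy bases, finite derivation type -/

/-- An edge `(w₁, r, ε, w₂)` of the derivation graph from `u` to `v`, where `r = (r₊, r₋)` is a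
rule and `ε = ±1` (`pos = true` for `+1`).  For `ε = +1` it goes from `w₁ r₊ w₂` to `w₁ r₋ w₂`,
and for `ε = -1` in the other direction. -/
@[ext]
structure Edge (rels : FreeMonoid A → FreeMonoid A → Prop) (u v : FreeMonoid A) where
  left : FreeMonoid A
  rule : FreeMonoid A × FreeMonoid A
  pos : Bool
  right : FreeMonoid A
  rule_mem : rels rule.1 rule.2
  src_eq : left * (if pos = true then rule.1 else rule.2) * right = u
  tgt_eq : left * (if pos = true then rule.2 else rule.1) * right = v

namespace Edge

variable {rels : FreeMonoid A → FreeMonoid A → Prop} {u v : FreeMonoid A}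

/-- The inverse edge `(w₁, r, -ε, w₂)`. -/
def inv (e : Edge rels u v) : Edge rels v u where
  left := e.left
  rule := e.rule
  pos := !e.pos
  right := e.right
  rule_mem := e.rule_mem
  src_eq := by have h := e.tgt_eq
               cases hp : e.pos <;> simpa [hp] using h
  tgt_eq := by have h := e.src_eq
               cases hp : e.pos <;> simpa [hp] using h

/-- The left action `x · e = (x w₁, r, ε, w₂)`. -/
def lmul (x : FreeMonoid A) (e : Edge rels u v) : Edge rels (x * u) (x * v) where
  left := x * e.left
  rule := e.rule
  pos := e.pos
  right := e.right
  rule_mem := e.rule_mem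
  src_eq := by conv_rhs => rw [← e.src_eq]
               simp only [mul_assoc]
  tgt_eq := by conv_rhs => rw [← e.tgt_eq]
               simp only [mul_assoc]

/-- The right action `e · y = (w₁, r, ε, w₂ y)`. -/
def rmul (e : Edge rels u v) (y : FreeMonoid A) : Edge rels (u * y) (v * y) where
  left := e.left
  rule := e.rule
  pos := e.pos
  right := e.right * y
  rule_mem := e.rule_mem
  src_eq := by conv_rhs => rw [← e.src_eq]
               simp only [mul_assoc]
  tgt_eq := by conv_rhs => rw [← e.tgt_eq]
               simp only [mul_assoc]

end Edge

/-- Paths from `u` to `v` in the derivation graph, whose vertices are the words over `A` and whose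
edges are the terms of `Edge rels u v`. -/
inductive DPath (rels : FreeMonoid A → FreeMonoid A → Prop) :
    FreeMonoid A → FreeMonoid A → Type u
  | nil (u : FreeMonoid A) : DPath rels u u
  | cons {u v w : FreeMonoid A} (e : Edge rels u v) (p : DPath rels v w) : DPath rels u w

variable {rels : FreeMonoid A → FreeMonoid A → Prop}

/-- An edge, as a path of length one. -/
def Edge.path {u v : FreeMonoid A} (e : Edge rels u v) : DPath rels u v :=
  .cons e (.nil v)

namespace DPath

/-- The composition `p ∘ q` (first `p`, then `q`). -/
def comp : ∀ {u v w : FreeMonoid A}, DPath rels u v → DPath rels v w → DPath rels u w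
  | _, _, _, .nil _, q => q
  | _, _, _, .cons e p, q => .cons e (p.comp q)

/-- The inverse path. -/
def inv : ∀ {u v : FreeMonoid A}, DPath rels u v → DPath rels v u
  | _, _, .nil u => .nil u
  | _, _, .cons e p => p.inv.comp e.inv.path

/-- The two-sided action of `A*` on paths, `x · p · y`. -/
def act (x y : FreeMonoid A) :
    ∀ {u v : FreeMonoid A}, DPath rels u v → DPath rels (x * u * y) (x * v * y)
  | _, _, .nil u => .nil (x * u * y)
  | _, _, .cons e p => .cons ((e.lmul x).rmul y) (p.act x y)

end DPath

variable (rels) in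
/-- A homotopy relation: an equivalence relation `E` on the paths of the derivation graph, contained
in the relation of being parallel (`E` compares only paths with the same ends), satisfying the
conditions (H1)-(H4) below. -/
structure IsHomotopyRelation
    (E : ∀ ⦃u v : FreeMonoid A⦄, DPath rels u v → DPath rels u v → Prop) : Prop where
  equiv : ∀ u v : FreeMonoid A, Equivalence (@E u v)
  /-- (H1): applications of rules at disjoint places commute. -/
  disjoint : ∀ {u₁ v₁ u₂ v₂ : FreeMonoid A} (e₁ : Edge rels u₁ v₁) (e₂ : Edge rels u₂ v₂),
    E ((e₁.rmul u₂).path.comp (e₂.lmul v₁).path) ((e₂.lmul u₁).path.comp (e₁.rmul v₂).path)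
  /-- (H2): invariance under the two-sided action. -/
  act : ∀ {u v : FreeMonoid A} (p q : DPath rels u v) (x y : FreeMonoid A),
    E p q → E (p.act x y) (q.act x y)
  /-- (H3): invariance under composition. -/
  comp : ∀ {t u v w : FreeMonoid A} (r : DPath rels t u) (p q : DPath rels u v)
    (s : DPath rels v w), E p q → E ((r.comp p).comp s) ((r.comp q).comp s)
  /-- (H4): a path followed by its inverse is homotopic to the empty path. -/
  inv : ∀ {u v : FreeMonoid A} (p : DPath rels u v), E (p.comp p.inv) (DPath.nil u)

variable (rels) in
/-- A pair of parallel paths. -/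
structure ParallelPair where
  src : FreeMonoid A
  tgt : FreeMonoid A
  fst : DPath rels src tgt
  snd : DPath rels src tgt

/-- The homotopy relation `∼_C` generated by `C`, i.e. the smallest homotopy relation containing
`C`. -/
def HomotopyGen (C : Set (ParallelPair rels)) ⦃u v : FreeMonoid A⦄ (p q : DPath rels u v) : Prop :=
  ∀ E : ∀ ⦃u v : FreeMonoid A⦄, DPath rels u v → DPath rels u v → Prop,
    IsHomotopyRelation rels E → (∀ c ∈ C, E c.fst c.snd) → E p q

/-- `C` is a homotopy base: `∼_C` relates any two parallel paths. -/
def IsHomotopyBase (C : Set (ParallelPair rels)) : Prop :=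
  ∀ ⦃u v : FreeMonoid A⦄ (p q : DPath rels u v), HomotopyGen C p q

variable (rels) in
/-- The presentation has finite derivation type: its derivation graph has a finite homotopy base. -/
def PresentationHasFDT : Prop :=
  ∃ C : Set (ParallelPair rels), C.Finite ∧ IsHomotopyBase C

/-- The monoid `S` has finite derivation type: it is defined by some finite presentation that has
finite derivation type. -/
def HasFDT (S : Type*) [Monoid S] : Prop :=
  ∃ (A : Type) (rels : FreeMonoid A → FreeMonoid A → Prop),
    Finite A ∧ FiniteRules rels ∧ Nonempty (S ≃* PresentedMonoid rels) ∧ PresentationHasFDT rels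

/-! ## Semimetric spaces and directed Cayley semimetrics -/

/-- A semimetric on `X`: the metric axioms without symmetry, with the value `∞` allowed. -/
structure Semimetric (X : Type*) where
  dist : X → X → ℝ≥0∞
  dist_eq_zero : ∀ x y, dist x y = 0 ↔ x = y
  triangle : ∀ x y z, dist x z ≤ dist x y + dist y z

/-- Two semimetric spaces are isometric: there is a distance-preserving bijection. -/
def Isometric {X Y : Type*} (dX : Semimetric X) (dY : Semimetric Y) : Prop :=
  ∃ f : X ≃ Y, ∀ x y, dY.dist (f x) (f y) = dX.dist x y

/-- `d_A(x, y) = inf {|w| : w ∈ A*, x w = y}`, where `g` gives the element of `S` represented by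
each letter. -/
noncomputable def wordDist {A S : Type*} [Monoid S] (g : A → S) (x y : S) : ℝ≥0∞ :=
  ⨅ w : {w : FreeMonoid A // x * FreeMonoid.lift g w = y}, (w.1.length : ℝ≥0∞)

theorem wordDist_le {A S : Type*} [Monoid S] (g : A → S) (x : S) (w : FreeMonoid A) :
    wordDist g x (x * FreeMonoid.lift g w) ≤ (w.length : ℝ≥0∞) :=
  iInf_le (fun w' : {w' : FreeMonoid A // x * FreeMonoid.lift g w' = x * FreeMonoid.lift g w} =>
    (w'.1.length : ℝ≥0∞)) ⟨w, rfl⟩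

theorem wordDist_eq_zero {A S : Type*} [Monoid S] (g : A → S) (x y : S) :
    wordDist g x y = 0 ↔ x = y := by
  constructor
  · intro h
    by_contra hne
    have h1 : (1 : ℝ≥0∞) ≤ wordDist g x y := by
      refine le_iInf fun w => ?_
      have hw : w.1.length ≠ 0 := by
        intro h0
        rw [FreeMonoid.length_eq_zero] at h0
        exact hne (by rw [← w.2, h0, map_one, mul_one])
      exact_mod_cast Nat.one_le_iff_ne_zero.mpr hw
    rw [h] at h1
    exact absurd h1 (by simp)
  · rintro rfl
    have h := wordDist_le g x 1
    rw [map_one, mul_one] at h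
    simpa using h

theorem wordDist_triangle {A S : Type*} [Monoid S] (g : A → S) (x y z : S) :
    wordDist g x z ≤ wordDist g x y + wordDist g y z := by
  refine ENNReal.le_iInf_add_iInf ?_
  rintro ⟨v, rfl⟩ ⟨w, rfl⟩
  have h := wordDist_le g x (v * w)
  rw [map_mul, ← mul_assoc, FreeMonoid.length_mul] at h
  exact_mod_cast h

/-- The semimetric space `(S, d_A)` of a monoid with a family of generators. -/
noncomputable def cayleySemimetric {A S : Type*} [Monoid S] (g : A → S) : Semimetric S where
  dist := wordDist g
  dist_eq_zero := wordDist_eq_zero g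
  triangle := wordDist_triangle g

/-- A property of monoids is an isometry invariant of finitely generated monoids if it agrees on any
two finitely generated monoids whose directed Cayley semimetric spaces, for some finite generating
families, are isometric. -/
def IsIsometryInvariant (P : ∀ (S : Type) [Monoid S], Prop) : Prop :=
  ∀ (S T A B : Type) [Monoid S] [Monoid T] [Finite A] [Finite B] (g : A → S) (k : B → T),
    Submonoid.closure (Set.range g) = ⊤ → Submonoid.closure (Set.range k) = ⊤ →
      Isometric (cayleySemimetric g) (cayleySemimetric k) → (P S ↔ P T)

/-! ## The two monoids -/

/-- The six generators `a, a⁻¹, b, b⁻¹, h, z`. -/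
inductive Gen
  | a | aInv | b | bInv | h | z

namespace Gen

/-- The generators `a, a⁻¹, b, b⁻¹`. -/
def groupLetters : Set Gen := {a, aInv, b, bInv}

end Gen

open FreeMonoid Gen

/-- The relations shared by both presentations. -/
inductive CommonRel : FreeMonoid Gen → FreeMonoid Gen → Prop
  | a_aInv : CommonRel (of a * of aInv) 1
  | aInv_a : CommonRel (of aInv * of a) 1
  | b_bInv : CommonRel (of b * of bInv) 1
  | bInv_b : CommonRel (of bInv * of b) 1
  | comm_h (x : Gen) (hx : x ∈ groupLetters) : CommonRel (of x * of h) (of h * of x)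
  | h_comm (x y : Gen) (hx : x ∈ groupLetters) (hy : y ∈ groupLetters) :
      CommonRel (of h * of x * of y) (of h * of y * of x)

/-- The defining relations of `M`. -/
inductive MRel : FreeMonoid Gen → FreeMonoid Gen → Prop
  | common {u v : FreeMonoid Gen} (huv : CommonRel u v) : MRel u v
  | hsq_mul (x : Gen) (hx : x ∈ groupLetters) : MRel (of h ^ 2 * of x) (of h ^ 2)
  | h_cube : MRel (of h ^ 3) (of h ^ 2)
  | hsq_z : MRel (of h ^ 2) (of z)

/-- The defining relations of `N`. -/
inductive NRel : FreeMonoid Gen → FreeMonoid Gen → Prop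
  | common {u v : FreeMonoid Gen} (huv : CommonRel u v) : NRel u v
  | z_mul (x : Gen) : NRel (of z * of x) (of z)
  | mul_z (x : Gen) : NRel (of x * of z) (of z)
  | h_idem : NRel (of h ^ 2) (of h)

end MonoidRewriting

/-! Let F be the free group on a, b. Both monoids are, as sets, F ∪ ℤ² ∪ {0}, where the middle layer
consists of the elements hg and only sees the exponent sums of g. They differ in one respect: a
product of two elements of the middle layer is 0 in M, while in N the middle layer is a group with
identity h (`equivM`, `equivN`). Hence the right Cayley graphs differ only in the h-edges leaving
the middle layer, which lead to 0 in M and are loops in N. Loops do not affect distances, and z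
already provides an edge to 0, so the identity on the common set is an isometry.

For N, new letters for the products hy make a finite complete system possible, and completeness
implies FDT by Squier's argument: resolving the finitely many short peaks gives a homotopy base
(`presentationHasFDT_of_isComplete`). By the same implication, it is enough for M to refute FDT.

For M, map F onto W = ℤ ≀ ℤ, written `Lamp`. A word representing an element of the middle layer has
exactly one letter in that layer. Lifting letters to W determines the position of such a word from
the element it represents, but not its lamps. A path therefore has a value: the sum of the lamp
changes of its edges, each translated by the left context. In ℤ[ℤ] this sum telescopes and depends
only on the ends, but it can be refined to ℤ[W/B] for every subgroup B = `Lamp.box n`. The boxes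
exhaust the kernel of the position map W → ℤ, so each given pair of parallel paths agrees in ℤ[W/B]
for all large n (`eventually_value_eq`). Equality of values is a homotopy relation
(`isHomotopyRelation_value`), so a finite homotopy base would make all parallel paths in the middle
layer agree for a single n. This is impossible (`exists_value_ne`): if k in F' satisfies hk = h =
kh, comparing the two ways of reducing khk' to h forces the value of hk' → h to be invariant under
an infinite set of translations, hence zero, although its image in ℤ[ℤ] is not. -/

namespace MonoidRewriting

/-! ## A model for the two monoids -/

/-- The disjoint union of a group `G`, of a homomorphic image `A` of `G` and of a zero element.
The product of two elements of `A` is taken in `A` if `idem` holds, and is zero otherwise. -/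
inductive Layered {G A : Type*} [Group G] [CommGroup A] (φ : G →* A) (idem : Bool)
  | grp (g : G)
  | ab (α : A)
  | zero

namespace Layered

variable {G A : Type*} [Group G] [CommGroup A] {φ : G →* A} {idem : Bool}

instance : One (Layered φ idem) := ⟨grp 1⟩

instance : Mul (Layered φ idem) where
  mul
    | grp g, grp g' => grp (g * g')
    | grp g, ab α => ab (φ g * α)
    | ab α, grp g => ab (α * φ g)
    | ab α, ab β => if idem then ab (α * β) else zero
    | zero, _ => zero
    | grp _, zero => zero
    | ab _, zero => zero

theorem one_def : (1 : Layered φ idem) = grp 1 := rfl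

@[simp] theorem grp_mul_grp (g g' : G) : (grp g * grp g' : Layered φ idem) = grp (g * g') := rfl

@[simp] theorem grp_mul_ab (g : G) (α : A) : (grp g * ab α : Layered φ idem) = ab (φ g * α) := rfl

@[simp] theorem ab_mul_grp (α : A) (g : G) : (ab α * grp g : Layered φ idem) = ab (α * φ g) := rfl

@[simp] theorem ab_mul_ab (α β : A) :
    (ab α * ab β : Layered φ idem) = if idem then ab (α * β) else zero := rfl

@[simp] theorem zero_mul' (x : Layered φ idem) : zero * x = zero := by cases x <;> rfl

@[simp] theorem mul_zero' (x : Layered φ idem) : x * zero = zero := by cases x <;> rfl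

instance : Monoid (Layered φ idem) where
  one_mul x := by cases x <;> simp [one_def]
  mul_one x := by cases x <;> simp [one_def]
  mul_assoc x y z := by
    cases idem <;> cases x <;> cases y <;> cases z <;> simp [mul_assoc]

/-- The universal property of `Layered φ idem`. -/
noncomputable def lift {P : Type*} [Monoid P] (hφ : Function.Surjective φ) (u : G →* P) (h z : P)
    (hu : ∀ g, u g * h = h * u g) (hker : ∀ g g', φ g = φ g' → h * u g = h * u g')
    (hh : h * h = if idem then h else z) (zu : ∀ g, z * u g = z) (uz : ∀ g, u g * z = z)
    (zh : z * h = z) (hz : h * z = z) (zz : z * z = z) : Layered φ idem →* P where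
  toFun
    | grp g => u g
    | ab α => h * u (Function.surjInv hφ α)
    | zero => z
  map_one' := map_one u
  map_mul' x y := by
    -- By `hker` the arbitrary preimage chosen in the definition can be replaced by any convenient
    -- one.
    have key (α : A) (g : G) (hg : φ g = α) : h * u (Function.surjInv hφ α) = h * u g :=
      hker _ _ (by rw [Function.surjInv_eq hφ, hg])
    cases x with
    | grp g =>
      cases y with
      | grp g' => exact map_mul u g g'
      | ab β =>
        obtain ⟨g', rfl⟩ := hφ β
        change h * u (Function.surjInv hφ (φ g * φ g')) = u g * (h * u (Function.surjInv hφ (φ g')))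
        rw [key _ (g * g') (map_mul φ g g'), key _ g' rfl, map_mul, ← mul_assoc, ← mul_assoc, hu]
      | zero => exact (uz g).symm
    | ab α =>
      obtain ⟨g, rfl⟩ := hφ α
      cases y with
      | grp g' =>
        change h * u (Function.surjInv hφ (φ g * φ g')) = h * u (Function.surjInv hφ (φ g)) * u g'
        rw [key _ (g * g') (map_mul φ g g'), key _ g rfl, map_mul, mul_assoc]
      | ab β =>
        obtain ⟨g', rfl⟩ := hφ β
        have e : h * u (Function.surjInv hφ (φ g)) * (h * u (Function.surjInv hφ (φ g')))
            = h * h * u (g * g') := by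
          rw [key _ g rfl, key _ g' rfl, map_mul, mul_assoc h, ← mul_assoc (u g), hu]
          simp only [mul_assoc]
        cases idem with
        | true =>
          refine Eq.trans ?_ e.symm
          change h * u (Function.surjInv hφ (φ g * φ g')) = _
          rw [key _ (g * g') (map_mul φ g g'), hh, if_pos rfl]
        | false =>
          refine Eq.trans ?_ e.symm
          change z = _
          rw [hh, if_neg (by simp), zu]
      | zero =>
        change z = h * _ * z
        rw [mul_assoc, uz, hz]
    | zero =>
      cases y with
      | grp g => exact (zu g).symm
      | ab β =>
        change z = z * (h * _)
        rw [← mul_assoc, zh, zu]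
      | zero => exact zz.symm

end Layered

/-- The exponent sums of an element of the free group of rank two. -/
def expSum : FreeGroup Bool →* Multiplicative ℤ × Multiplicative ℤ :=
  -- The letter `false` plays the role of a (first coordinate) and `true` that of b (second
  -- coordinate).
  FreeGroup.lift fun b => if b then (1, .ofAdd 1) else (.ofAdd 1, 1)

theorem expSum_of (b : Bool) :
    expSum (.of b) = if b then (1, .ofAdd 1) else (.ofAdd 1, 1) := FreeGroup.lift_apply_of

theorem expSum_surjective : Function.Surjective expSum := by
  rintro ⟨i, j⟩
  refine ⟨.of false ^ i.toAdd * .of true ^ j.toAdd, ?_⟩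
  rw [map_mul, map_zpow, map_zpow, expSum_of, expSum_of]
  ext <;> simp [← ofAdd_zsmul]

open FreeMonoid Gen

/-- The model of `M` (for `idem = false`) and of `N` (for `idem = true`). -/
abbrev Model (idem : Bool) : Type := Layered expSum idem

/-- The elements of the model that the six generators represent. -/
def Gen.model (idem : Bool) : Gen → Model idem
  | a => .grp (.of false)
  | aInv => .grp (.of false)⁻¹
  | b => .grp (.of true)
  | bInv => .grp (.of true)⁻¹
  | h => .ab 1
  | z => .zero

theorem model_common (idem : Bool) {u v : FreeMonoid Gen} (huv : CommonRel u v) :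
    FreeMonoid.lift (Gen.model idem) u = FreeMonoid.lift (Gen.model idem) v := by
  cases huv with
  | comm_h x hx => rcases hx with rfl | rfl | rfl | rfl <;> simp [Gen.model, mul_comm]
  | h_comm x y hx hy =>
    rcases hx with rfl | rfl | rfl | rfl <;> rcases hy with rfl | rfl | rfl | rfl <;>
      simp [Gen.model, mul_comm]
  | _ => simp [Gen.model, Layered.one_def]

theorem model_MRel {u v : FreeMonoid Gen} (huv : MRel u v) :
    FreeMonoid.lift (Gen.model false) u = FreeMonoid.lift (Gen.model false) v := by
  cases huv with
  | common h => exact model_common _ h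
  | hsq_mul x hx => simp [Gen.model, sq]
  | _ => simp [Gen.model, pow_succ]

theorem model_NRel {u v : FreeMonoid Gen} (huv : NRel u v) :
    FreeMonoid.lift (Gen.model true) u = FreeMonoid.lift (Gen.model true) v := by
  cases huv with
  | common h => exact model_common _ h
  | _ => simp [Gen.model, pow_succ]

/-! ### Homomorphisms from the model, obtained from the defining relations. -/

section Common

variable {P : Type*} [Monoid P] {f : Gen → P}

theorem exists_unitsHom
    (hf : ∀ {u v : FreeMonoid Gen}, CommonRel u v → FreeMonoid.lift f u = FreeMonoid.lift f v) :
    ∃ u : FreeGroup Bool →* P, u (.of false) = f a ∧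
      u (.of false)⁻¹ = f aInv ∧ u (.of true) = f b ∧ u (.of true)⁻¹ = f bInv := by
  have h₁ : f a * f aInv = 1 := by simpa using hf .a_aInv
  have h₂ : f aInv * f a = 1 := by simpa using hf .aInv_a
  have h₃ : f b * f bInv = 1 := by simpa using hf .b_bInv
  have h₄ : f bInv * f b = 1 := by simpa using hf .bInv_b
  refine ⟨(Units.coeHom P).comp (FreeGroup.lift fun c => if c then ⟨f b, f bInv, h₃, h₄⟩
    else ⟨f a, f aInv, h₁, h₂⟩), by simp, ?_, by simp, ?_⟩ <;>
  · simp only [MonoidHom.comp_apply, map_inv, FreeGroup.lift_apply_of]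
    rfl

theorem freeGroup_induction {p : FreeGroup Bool → Prop} (one : p 1)
    (gens : ∀ c, p (.of c) ∧ p (.of c)⁻¹) (mul : ∀ g g', p g → p g' → p (g * g'))
    (g : FreeGroup Bool) : p g :=
  FreeGroup.induction_on g one (fun c => (gens c).1) (fun c _ => (gens c).2) mul

/-- The commutation relations pass from letters to all of F by induction, so `f h * u g` depends
only on the exponent sums of `g`. This is the compatibility that `Layered.lift` requires. -/
theorem exists_model_hom {idem : Bool}
    (hf : ∀ {u v : FreeMonoid Gen}, CommonRel u v → FreeMonoid.lift f u = FreeMonoid.lift f v)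
    (zx : ∀ x, f z * f x = f z) (xz : ∀ x, f x * f z = f z)
    (hh : f h * f h = if idem then f h else f z) :
    ∃ F : Model idem →* P, ∀ x, F (Gen.model idem x) = f x := by
  obtain ⟨u, ua, ua', ub, ub'⟩ := exists_unitsHom hf
  have letters (c : Bool) : (∃ x ∈ groupLetters, u (.of c) = f x) ∧
      ∃ x ∈ groupLetters, u (.of c)⁻¹ = f x := by
    cases c
    · exact ⟨⟨a, by simp [groupLetters], ua⟩, ⟨aInv, by simp [groupLetters], ua'⟩⟩
    · exact ⟨⟨b, by simp [groupLetters], ub⟩, ⟨bInv, by simp [groupLetters], ub'⟩⟩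
  have gens {p : P → Prop} (hp : ∀ x ∈ groupLetters, p (f x)) (c : Bool) :
      p (u (.of c)) ∧ p (u (.of c)⁻¹) := by
    obtain ⟨⟨x, hx, ex⟩, ⟨y, hy, ey⟩⟩ := letters c
    rw [ex, ey]
    exact ⟨hp x hx, hp y hy⟩
  have hu (g : FreeGroup Bool) : u g * f h = f h * u g := by
    induction g using freeGroup_induction with
    | one => simp
    | gens c =>
      exact gens (p := fun t => t * f h = f h * t) (fun x hx => by simpa using hf (.comm_h x hx)) c
    | mul g g' h₁ h₂ => rw [map_mul, mul_assoc, h₂, ← mul_assoc, h₁, mul_assoc]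
  have zu (g : FreeGroup Bool) : f z * u g = f z := by
    induction g using freeGroup_induction with
    | one => simp
    | gens c => exact gens (p := fun t => f z * t = f z) (fun x _ => zx x) c
    | mul g g' h₁ h₂ => rw [map_mul, ← mul_assoc, h₁, h₂]
  have uz (g : FreeGroup Bool) : u g * f z = f z := by
    induction g using freeGroup_induction with
    | one => simp
    | gens c => exact gens (p := fun t => t * f z = f z) (fun x _ => xz x) c
    | mul g g' h₁ h₂ => rw [map_mul, mul_assoc, h₂, h₁]
  have comm₁ (x : Gen) (hx : x ∈ groupLetters) (g : FreeGroup Bool) :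
      f h * f x * u g = f h * u g * f x := by
    induction g using freeGroup_induction with
    | one => simp
    | gens c =>
      exact gens (p := fun t => f h * f x * t = f h * t * f x)
        (fun y hy => by simpa using hf (.h_comm x y hx hy)) c
    | mul g g' h₁ h₂ =>
      rw [map_mul, ← mul_assoc, h₁, ← hu, mul_assoc (u g), mul_assoc (u g), h₂, ← mul_assoc,
        ← mul_assoc, hu, mul_assoc (f h)]
  have comm₂ (g g' : FreeGroup Bool) : f h * u g * u g' = f h * u g' * u g := by
    induction g using freeGroup_induction with
    | one => simp
    | gens c =>
      exact gens (p := fun t => f h * t * u g' = f h * u g' * t) (fun x hx => comm₁ x hx g') c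
    | mul g₁ g₂ h₁ h₂ =>
      rw [map_mul, ← mul_assoc, ← hu, mul_assoc (u g₁), mul_assoc (u g₁), h₂, ← mul_assoc,
        ← mul_assoc, hu, h₁, mul_assoc]
  -- Behind h, every group element can be sorted into the form aⁱbʲ.
  have normal (g : FreeGroup Bool) : f h * u g =
      f h * u (.of false ^ (expSum g).1.toAdd * .of true ^ (expSum g).2.toAdd) := by
    induction g using freeGroup_induction with
    | one => simp
    | gens c => cases c <;> simp [expSum_of]
    | mul g g' h₁ h₂ =>
      rw [map_mul u g g', ← mul_assoc, h₁, ← hu, mul_assoc, h₂]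
      have e (p q r s : FreeGroup Bool) : u (p * q) * (f h * u (r * s)) =
          f h * u (p * r * (q * s)) := by
        rw [← mul_assoc, hu]
        simp only [map_mul, ← mul_assoc]
        rw [← hu, mul_assoc (u p), mul_assoc (u p), comm₂, ← mul_assoc (u p), ← mul_assoc (u p)]
      rw [e, map_mul expSum, Prod.fst_mul, Prod.snd_mul, toAdd_mul, toAdd_mul, zpow_add, zpow_add]
  refine ⟨Layered.lift expSum_surjective u (f h) (f z) hu
    (fun g g' e => by rw [normal g, normal g', e]) hh zu uz (zx h) (xz h) (zx z), ?_⟩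
  rintro (_ | _ | _ | _ | _ | _)
  · exact ua
  · exact ua'
  · exact ub
  · exact ub'
  · change f h * u (Function.surjInv expSum_surjective 1) = _
    rw [normal, Function.surjInv_eq expSum_surjective]
    simp
  · rfl

end Common

theorem closure_range_model (idem : Bool) :
    Submonoid.closure (Set.range (Gen.model idem)) = ⊤ := by
  have mem (x : Gen) : Gen.model idem x ∈ Submonoid.closure (Set.range (Gen.model idem)) :=
    Submonoid.subset_closure ⟨x, rfl⟩
  have hgrp (g : FreeGroup Bool) :
      (.grp g : Model idem) ∈ Submonoid.closure (Set.range (Gen.model idem)) := by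
    induction g using freeGroup_induction with
    | one => exact one_mem _
    | gens c =>
      cases c
      · exact ⟨mem a, mem aInv⟩
      · exact ⟨mem b, mem bInv⟩
    | mul g g' h₁ h₂ => exact mul_mem h₁ h₂
  rw [Submonoid.eq_top_iff']
  rintro (g | α | _)
  · exact hgrp g
  · obtain ⟨g, rfl⟩ := expSum_surjective α
    have := mul_mem (mem h) (hgrp g)
    rwa [Gen.model, Layered.ab_mul_grp, one_mul] at this
  · exact mem z

/-- A monoid with the presentation `rels` is isomorphic to the model if the model satisfies the
relations and maps to the presented monoid compatibly with the generators. -/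
noncomputable def modelEquiv {idem : Bool} {rels : FreeMonoid Gen → FreeMonoid Gen → Prop}
    (h : ∀ u v, rels u v →
      FreeMonoid.lift (Gen.model idem) u = FreeMonoid.lift (Gen.model idem) v)
    (F : Model idem →* PresentedMonoid rels)
    (hF : ∀ x, F (Gen.model idem x) = PresentedMonoid.of rels x) :
    PresentedMonoid rels ≃* Model idem :=
  MonoidHom.toMulEquiv (PresentedMonoid.lift (Gen.model idem) h) F
    (PresentedMonoid.ext _ fun x => by simp [hF])
    (MonoidHom.eq_of_eqOn_denseM (closure_range_model idem)
      (by rintro _ ⟨x, rfl⟩; simp [hF]))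

theorem lift_of_eq {rels : FreeMonoid Gen → FreeMonoid Gen → Prop} {u v : FreeMonoid Gen}
    (huv : rels u v) :
    FreeMonoid.lift (PresentedMonoid.of rels) u = FreeMonoid.lift (PresentedMonoid.of rels) v := by
  have e : FreeMonoid.lift (PresentedMonoid.of rels) = PresentedMonoid.mk rels :=
    FreeMonoid.hom_eq fun x => by simp [PresentedMonoid.of]
  rw [e]
  exact PresentedMonoid.mk_eq_mk_of_rel huv

/-- The point to check is that z = h² is a two-sided zero. The relations only make h² absorb on the
right; absorption on the left follows because h commutes with the group letters. -/
theorem exists_hom_M : ∃ F : Model false →* PresentedMonoid MRel,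
    ∀ x, F (Gen.model false x) = PresentedMonoid.of MRel x := by
  set f := PresentedMonoid.of MRel
  have hz : f h * f h = f z := by simpa [sq] using lift_of_eq MRel.hsq_z
  have zh : f z * f h = f z := by
    have := lift_of_eq MRel.h_cube
    simp only [map_pow, FreeMonoid.lift_eval_of] at this
    rw [← hz, ← sq, ← pow_succ]
    exact this
  have hz' : f h * f z = f z := by
    rw [← hz, ← mul_assoc, hz, zh]
  have zg (x : Gen) (hx : x ∈ groupLetters) : f z * f x = f z := by
    have := lift_of_eq (MRel.hsq_mul x hx)
    simp only [map_pow, map_mul, FreeMonoid.lift_eval_of] at this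
    rw [← hz, ← sq]
    exact this
  have gz (x : Gen) (hx : x ∈ groupLetters) : f x * f z = f z := by
    have := lift_of_eq (MRel.common (.comm_h x hx))
    simp only [map_mul, FreeMonoid.lift_eval_of] at this
    change f x * f h = f h * f x at this
    calc f x * f z = f x * f h * f h := by rw [← hz, mul_assoc]
      _ = f h * (f x * f h) := by rw [this, mul_assoc, this]
      _ = f z * f x := by rw [this, ← mul_assoc, hz]
      _ = f z := zg x hx
  have zz : f z * f z = f z := by
    calc f z * f z = f h * (f h * f z) := by rw [← mul_assoc, hz]
      _ = f z := by rw [hz', hz']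
  refine exists_model_hom (fun huv => lift_of_eq (.common huv)) (fun x => ?_) (fun x => ?_) hz
  · rcases x with _ | _ | _ | _ | _ | _
    · exact zg a (by simp [groupLetters])
    · exact zg aInv (by simp [groupLetters])
    · exact zg b (by simp [groupLetters])
    · exact zg bInv (by simp [groupLetters])
    · exact zh
    · exact zz
  · rcases x with _ | _ | _ | _ | _ | _
    · exact gz a (by simp [groupLetters])
    · exact gz aInv (by simp [groupLetters])
    · exact gz b (by simp [groupLetters])
    · exact gz bInv (by simp [groupLetters])
    · exact hz'
    · exact zz

theorem exists_hom_N : ∃ F : Model true →* PresentedMonoid NRel,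
    ∀ x, F (Gen.model true x) = PresentedMonoid.of NRel x :=
  exists_model_hom (fun huv => lift_of_eq (.common huv))
    (fun x => by simpa using lift_of_eq (NRel.z_mul x))
    (fun x => by simpa using lift_of_eq (NRel.mul_z x))
    (by simpa [sq] using lift_of_eq NRel.h_idem)

/-- The monoid `M` is isomorphic to its model. -/
noncomputable def equivM : PresentedMonoid MRel ≃* Model false :=
  modelEquiv (fun _ _ => model_MRel) exists_hom_M.choose exists_hom_M.choose_spec

/-- The monoid `N` is isomorphic to its model. -/
noncomputable def equivN : PresentedMonoid NRel ≃* Model true :=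
  modelEquiv (fun _ _ => model_NRel) exists_hom_N.choose exists_hom_N.choose_spec

theorem equivM_of (x : Gen) : equivM (PresentedMonoid.of MRel x) = Gen.model false x := rfl

theorem equivN_of (x : Gen) : equivN (PresentedMonoid.of NRel x) = Gen.model true x := rfl

/-! ## The isometry -/

/-- Along a word, each letter can be replaced by a word of length at most one, so no path in the
Cayley graph gets longer under `f`. -/
theorem wordDist_le_wordDist {A B S T : Type*} [Monoid S] [Monoid T] (g : A → S) (k : B → T)
    (f : S → T)
    (step : ∀ x s, ∃ w : FreeMonoid B, w.length ≤ 1 ∧ f x * FreeMonoid.lift k w = f (x * g s))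
    (x y : S) : wordDist k (f x) (f y) ≤ wordDist g x y := by
  refine le_iInf ?_
  rintro ⟨w, rfl⟩
  have key : ∃ w' : FreeMonoid B, w'.length ≤ w.length ∧
      f x * FreeMonoid.lift k w' = f (x * FreeMonoid.lift g w) := by
    induction w using FreeMonoid.inductionOn' generalizing x with
    | one => exact ⟨1, le_rfl, by simp⟩
    | of_mul s w ih =>
      obtain ⟨w₁, h₁, e₁⟩ := step x s
      obtain ⟨w₂, h₂, e₂⟩ := ih (x * g s)
      refine ⟨w₁ * w₂, ?_, ?_⟩
      · rw [FreeMonoid.length_mul, FreeMonoid.length_mul, FreeMonoid.length_of]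
        omega
      · rw [map_mul, ← mul_assoc, e₁, e₂, map_mul, FreeMonoid.lift_eval_of, mul_assoc]
  obtain ⟨w', hw', e⟩ := key
  rw [← e]
  exact (wordDist_le k (f x) w').trans (by exact_mod_cast hw')

/-- The models of `M` and `N` have the same elements. -/
def Layered.relabel {G A : Type*} [Group G] [CommGroup A] {φ : G →* A} (i j : Bool) :
    Layered φ i ≃ Layered φ j where
  toFun | .grp g => .grp g | .ab α => .ab α | .zero => .zero
  invFun | .grp g => .grp g | .ab α => .ab α | .zero => .zero
  left_inv x := by cases x <;> rfl
  right_inv x := by cases x <;> rfl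

/-- Only the letter h acting on the middle layer needs care. An h-edge to zero in M is replaced by z
in N, and an h-loop in N is replaced by the empty word in M. -/
theorem relabel_step (i j : Bool) (x : Model i) (s : Gen) :
    ∃ w : FreeMonoid Gen, w.length ≤ 1 ∧ Layered.relabel i j x * FreeMonoid.lift (Gen.model j) w =
      Layered.relabel i j (x * Gen.model i s) := by
  by_cases hs : s = h
  · subst hs
    cases x with
    | ab α =>
      cases i <;> cases j
      · exact ⟨of h, by simp, by simp [Layered.relabel, Gen.model]⟩
      · exact ⟨of z, by simp, by simp [Layered.relabel, Gen.model]⟩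
      · exact ⟨1, by simp, by simp [Layered.relabel, Gen.model]⟩
      · exact ⟨of h, by simp, by simp [Layered.relabel, Gen.model]⟩
    | _ => exact ⟨of h, by simp, by simp [Layered.relabel, Gen.model]⟩
  · refine ⟨of s, by simp, ?_⟩
    cases x <;> cases s <;> first | exact absurd rfl hs | simp [Layered.relabel, Gen.model]

theorem wordDist_map {A S T : Type*} [Monoid S] [Monoid T] (e : S ≃* T) (g : A → S) (k : A → T)
    (he : ∀ s, e (g s) = k s) (x y : S) : wordDist k (e x) (e y) = wordDist g x y := by
  refine le_antisymm (wordDist_le_wordDist g k e (fun x s => ⟨of s, by simp, by simp [he]⟩) x y) ?_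
  conv_lhs => rw [← e.symm_apply_apply x, ← e.symm_apply_apply y]
  exact wordDist_le_wordDist k g e.symm
    (fun x s => ⟨of s, by simp, by simp [← he]⟩) _ _

theorem isometric_M_N : Isometric (cayleySemimetric (PresentedMonoid.of MRel))
    (cayleySemimetric (PresentedMonoid.of NRel)) := by
  refine ⟨(equivM.toEquiv.trans (Layered.relabel false true)).trans equivN.symm.toEquiv,
    fun x y => ?_⟩
  change wordDist _ (equivN.symm (Layered.relabel false true (equivM x)))
    (equivN.symm (Layered.relabel false true (equivM y))) = wordDist _ x y
  rw [wordDist_map equivN.symm (Gen.model true) _ fun s => by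
      rw [← equivN_of, MulEquiv.symm_apply_apply],
    ← wordDist_map equivM _ (Gen.model false) equivM_of]
  refine le_antisymm (wordDist_le_wordDist _ _ _ (relabel_step false true) _ _) ?_
  have := wordDist_le_wordDist _ _ (Layered.relabel true false) (relabel_step true false)
    (Layered.relabel false true (equivM x)) (Layered.relabel false true (equivM y))
  have e (t : Model false) : Layered.relabel true false (Layered.relabel false true t) = t := by
    cases t <;> rfl
  rwa [e, e] at this

end MonoidRewriting

namespace MonoidRewriting

/-! ## Finite complete presentations have finite derivation type -/

universe u

variable {A : Type u} {rels : FreeMonoid A → FreeMonoid A → Prop}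

namespace DPath

@[simp] theorem nil_comp {u v : FreeMonoid A} (p : DPath rels u v) : (nil u).comp p = p := rfl

@[simp] theorem cons_comp {t u v w : FreeMonoid A} (e : Edge rels t u) (p : DPath rels u v)
    (q : DPath rels v w) : (cons e p).comp q = cons e (p.comp q) := rfl

@[simp] theorem comp_nil {u v : FreeMonoid A} (p : DPath rels u v) : p.comp (nil v) = p := by
  induction p with
  | nil => rfl
  | cons e p ih => rw [cons_comp, ih]

theorem comp_assoc {t u v w : FreeMonoid A} (p : DPath rels t u) (q : DPath rels u v)
    (r : DPath rels v w) : (p.comp q).comp r = p.comp (q.comp r) := by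
  induction p with
  | nil => rfl
  | cons e p ih => rw [cons_comp, cons_comp, cons_comp, ih]

/-- All edges of the path are applications of rules in the direction of reduction. -/
def IsPos : ∀ {u v : FreeMonoid A}, DPath rels u v → Prop
  | _, _, .nil _ => True
  | _, _, .cons e p => e.pos = true ∧ p.IsPos

theorem IsPos.comp {u v w : FreeMonoid A} {p : DPath rels u v} {q : DPath rels v w}
    (hp : p.IsPos) (hq : q.IsPos) : (p.comp q).IsPos := by
  induction p with
  | nil => exact hq
  | cons e p ih => exact ⟨hp.1, ih hp.2 hq⟩

theorem IsPos.act {u v : FreeMonoid A} {p : DPath rels u v} (hp : p.IsPos) (x y : FreeMonoid A) :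
    (p.act x y).IsPos := by
  induction p with
  | nil => trivial
  | cons e p ih => exact ⟨hp.1, ih hp.2⟩

end DPath

theorem Edge.step {u v : FreeMonoid A} (e : Edge rels u v) (he : e.pos = true) : Step rels u v :=
  ⟨e.left, e.rule.1, e.rule.2, e.right, e.rule_mem, by simpa [he] using e.src_eq.symm,
    by simpa [he] using e.tgt_eq.symm⟩

/-- The application of the rule `r` in the context `l`, `s`. -/
def ruleEdge (l : FreeMonoid A) (r : FreeMonoid A × FreeMonoid A) (s : FreeMonoid A)
    (h : rels r.1 r.2) {u : FreeMonoid A} (hu : l * r.1 * s = u) : Edge rels u (l * r.2 * s) where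
  left := l
  rule := r
  pos := true
  right := s
  rule_mem := h
  src_eq := by simpa using hu
  tgt_eq := by simp

theorem Step.exists_edge {u v : FreeMonoid A} (h : Step rels u v) :
    ∃ e : Edge rels u v, e.pos = true := by
  obtain ⟨l, r, r', s, hr, rfl, rfl⟩ := h
  exact ⟨ruleEdge l (r, r') s hr rfl, rfl⟩

theorem DPath.IsPos.reflTransGen {u v : FreeMonoid A} {p : DPath rels u v} (hp : p.IsPos) :
    Relation.ReflTransGen (Step rels) u v := by
  induction p with
  | nil => exact .refl
  | cons e p ih => exact .head (e.step hp.1) (ih hp.2)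

theorem exists_isPos {u v : FreeMonoid A} (h : Relation.ReflTransGen (Step rels) u v) :
    ∃ p : DPath rels u v, p.IsPos := by
  induction h using Relation.ReflTransGen.head_induction_on with
  | refl => exact ⟨.nil _, trivial⟩
  | head h _ ih =>
    obtain ⟨e, he⟩ := h.exists_edge
    obtain ⟨p, hp⟩ := ih
    exact ⟨.cons e p, he, hp⟩

/-! ### Resolution of peaks up to homotopy. -/

section Homotopy

variable {E : ∀ ⦃u v : FreeMonoid A⦄, DPath rels u v → DPath rels u v → Prop}

namespace IsHomotopyRelation

variable (hE : IsHomotopyRelation rels E)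

include hE

theorem refl {u v : FreeMonoid A} (p : DPath rels u v) : E p p := (hE.equiv u v).refl p

theorem symm {u v : FreeMonoid A} {p q : DPath rels u v} (h : E p q) : E q p :=
  (hE.equiv u v).symm h

theorem trans {u v : FreeMonoid A} {p q r : DPath rels u v} (h : E p q) (h' : E q r) : E p r :=
  (hE.equiv u v).trans h h'

theorem comp_left {u v w : FreeMonoid A} (r : DPath rels u v) {p q : DPath rels v w} (h : E p q) :
    E (r.comp p) (r.comp q) := by
  simpa using hE.comp r p q (.nil w) h

theorem cons {u v w : FreeMonoid A} (e : Edge rels u v) {p q : DPath rels v w} (h : E p q) :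
    E (.cons e p) (.cons e q) := hE.comp_left e.path h

theorem comp_right {u v w : FreeMonoid A} {p q : DPath rels u v} (h : E p q) (s : DPath rels v w) :
    E (p.comp s) (q.comp s) := by
  simpa using hE.comp (.nil u) p q s h

end IsHomotopyRelation

variable (E) in
/-- The edges `e₁`, `e₂` can be completed by reductions to homotopic paths. -/
def Joins {u v₁ v₂ : FreeMonoid A} (e₁ : Edge rels u v₁) (e₂ : Edge rels u v₂) : Prop :=
  ∃ (t : FreeMonoid A) (p₁ : DPath rels v₁ t) (p₂ : DPath rels v₂ t), p₁.IsPos ∧ p₂.IsPos ∧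
    E (.cons e₁ p₁) (.cons e₂ p₂)

theorem Joins.symm (hE : IsHomotopyRelation rels E) {u v₁ v₂ : FreeMonoid A} {e₁ : Edge rels u v₁}
    {e₂ : Edge rels u v₂} (h : Joins E e₁ e₂) : Joins E e₂ e₁ := by
  obtain ⟨t, p₁, p₂, h₁, h₂, h⟩ := h
  exact ⟨t, p₂, p₁, h₂, h₁, hE.symm h⟩

/-- The edge `e` is obtained from `f` by the action of `x` and `y`. -/
def Edge.IsAct {u v u' v' : FreeMonoid A} (e : Edge rels u v) (x : FreeMonoid A)
    (f : Edge rels u' v') (y : FreeMonoid A) : Prop :=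
  e.left = x * f.left ∧ e.rule = f.rule ∧ e.pos = f.pos ∧ e.right = f.right * y

theorem Edge.IsAct.src {u v u' v' x y : FreeMonoid A} {e : Edge rels u v} {f : Edge rels u' v'}
    (h : e.IsAct x f y) : u = x * u' * y := by
  obtain ⟨h₁, h₂, h₃, h₄⟩ := h
  rw [← e.src_eq, ← f.src_eq, h₁, h₂, h₃, h₄]
  simp only [mul_assoc]

theorem Edge.IsAct.tgt {u v u' v' x y : FreeMonoid A} {e : Edge rels u v} {f : Edge rels u' v'}
    (h : e.IsAct x f y) : v = x * v' * y := by
  obtain ⟨h₁, h₂, h₃, h₄⟩ := h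
  rw [← e.tgt_eq, ← f.tgt_eq, h₁, h₂, h₃, h₄]
  simp only [mul_assoc]

/-- `Edge.IsAct` compares the data of edges rather than edges themselves, because the ends of `e₁`
and `e₂` agree with those of the acted edges only up to an equality of words. -/
theorem Joins.act (hE : IsHomotopyRelation rels E) {u v₁ v₂ u' v₁' v₂' x y : FreeMonoid A}
    {e₁ : Edge rels u v₁} {e₂ : Edge rels u v₂} {f₁ : Edge rels u' v₁'} {f₂ : Edge rels u' v₂'}
    (h : Joins E f₁ f₂) (h₁ : e₁.IsAct x f₁ y) (h₂ : e₂.IsAct x f₂ y) : Joins E e₁ e₂ := by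
  obtain rfl := h₁.src
  obtain rfl := h₁.tgt
  obtain rfl := h₂.tgt
  obtain rfl : e₁ = (f₁.lmul x).rmul y := Edge.ext h₁.1 h₁.2.1 h₁.2.2.1 h₁.2.2.2
  obtain rfl : e₂ = (f₂.lmul x).rmul y := Edge.ext h₂.1 h₂.2.1 h₂.2.2.1 h₂.2.2.2
  obtain ⟨t, p₁, p₂, hp₁, hp₂, h⟩ := h
  exact ⟨x * t * y, p₁.act x y, p₂.act x y, hp₁.act x y, hp₂.act x y, hE.act _ _ x y h⟩

/-- The commuting square of (H1) closes the peak. -/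
theorem joins_of_disjoint (hE : IsHomotopyRelation rels E) {u₁ v₁ u₂ v₂ u w₁ w₂ : FreeMonoid A}
    {e₁ : Edge rels u w₁} {e₂ : Edge rels u w₂} {f₁ : Edge rels u₁ v₁} {f₂ : Edge rels u₂ v₂}
    (hf₁ : f₁.pos = true) (hf₂ : f₂.pos = true)
    (h₁ : e₁.IsAct 1 f₁ u₂) (h₂ : e₂.IsAct u₁ f₂ 1) : Joins E e₁ e₂ := by
  obtain rfl : u = u₁ * u₂ := by simpa using h₁.src
  obtain rfl : w₁ = v₁ * u₂ := by simpa using h₁.tgt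
  obtain rfl : w₂ = u₁ * v₂ := by simpa using h₂.tgt
  obtain rfl : e₁ = f₁.rmul u₂ :=
    Edge.ext (by simpa [Edge.rmul] using h₁.1) h₁.2.1 h₁.2.2.1 (by simpa [Edge.rmul] using h₁.2.2.2)
  obtain rfl : e₂ = f₂.lmul u₁ :=
    Edge.ext (by simpa [Edge.lmul] using h₂.1) h₂.2.1 h₂.2.2.1 (by simpa [Edge.lmul] using h₂.2.2.2)
  exact ⟨v₁ * v₂, (f₂.lmul v₁).path, (f₁.rmul v₂).path, ⟨hf₂, trivial⟩, ⟨hf₁, trivial⟩,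
    hE.disjoint f₁ f₂⟩

theorem mul_eq_mul_cases {x y z w : FreeMonoid A} (h : x * y = z * w) :
    (∃ m, z = x * m ∧ y = m * w) ∨ ∃ m, x = z * m ∧ w = m * y :=
  List.append_eq_append_iff.1 h

/-- If all peaks with a short source can be joined, then all peaks can be joined. -/
theorem joins_of_short (hE : IsHomotopyRelation rels E) {K : ℕ}
    (hK : ∀ l r, rels l r → l.length ≤ K)
    (short : ∀ {u v₁ v₂ : FreeMonoid A} (e₁ : Edge rels u v₁) (e₂ : Edge rels u v₂),
      e₁.pos = true → e₂.pos = true → u.length ≤ K + K → Joins E e₁ e₂)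
    {u v₁ v₂ : FreeMonoid A} (e₁ : Edge rels u v₁) (e₂ : Edge rels u v₂)
    (h₁ : e₁.pos = true) (h₂ : e₂.pos = true) : Joins E e₁ e₂ := by
  -- By symmetry the left-hand side of `e₁` may be assumed to start no later than that of `e₂`.
  have main {u v₁ v₂ : FreeMonoid A} (e₁ : Edge rels u v₁) (e₂ : Edge rels u v₂)
      (h₁ : e₁.pos = true) (h₂ : e₂.pos = true) (m : FreeMonoid A) (hl : e₂.left = e₁.left * m)
      (hr : e₁.rule.1 * e₁.right = m * (e₂.rule.1 * e₂.right)) : Joins E e₁ e₂ := by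
    have hK₁ := hK _ _ e₁.rule_mem
    have hK₂ := hK _ _ e₂.rule_mem
    -- Either the two left-hand sides are disjoint, or the second starts inside the first. In the
    -- latter case it is nested in the first or overlaps its end; the factor covered by both then
    -- has length at most 2K, and the rest of the word is context.
    rcases mul_eq_mul_cases hr with ⟨k, hk, hs⟩ | ⟨k, hk, hs⟩
    · refine joins_of_disjoint hE (f₁ := ruleEdge e₁.left e₁.rule 1 e₁.rule_mem rfl)
        (f₂ := ruleEdge k e₂.rule e₂.right e₂.rule_mem rfl) rfl rfl ⟨?_, rfl, h₁, ?_⟩ ⟨?_, rfl, h₂, ?_⟩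
      · simp [ruleEdge]
      · simp [ruleEdge, hs, mul_assoc]
      · simp [ruleEdge, hl, hk, mul_assoc]
      · simp [ruleEdge]
    · rcases mul_eq_mul_cases hs with ⟨j, hj, ht⟩ | ⟨j, hj, ht⟩
      · refine (short (ruleEdge 1 e₁.rule 1 e₁.rule_mem (by simp))
          (ruleEdge m e₂.rule j e₂.rule_mem (u := e₁.rule.1) (by rw [hk, hj, mul_assoc]))
          rfl rfl (by omega)).act hE (x := e₁.left) (y := e₁.right)
          ⟨?_, rfl, h₁, ?_⟩ ⟨hl, rfl, h₂, ht⟩ <;> simp [ruleEdge]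
      · refine (short (ruleEdge 1 e₁.rule j e₁.rule_mem (by simp))
          (ruleEdge m e₂.rule 1 e₂.rule_mem (u := e₁.rule.1 * j) (by simp [hk, hj, mul_assoc]))
          rfl rfl ?_).act hE (x := e₁.left) (y := e₂.right)
          ⟨?_, rfl, h₁, ht⟩ ⟨hl, rfl, h₂, ?_⟩
        · rw [hj, FreeMonoid.length_mul] at hK₂
          rw [FreeMonoid.length_mul]
          omega
        · simp [ruleEdge]
        · simp [ruleEdge]
  have src : e₁.left * (e₁.rule.1 * e₁.right) = e₂.left * (e₂.rule.1 * e₂.right) := by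
    rw [← mul_assoc, ← mul_assoc]
    simpa [h₁, h₂] using e₁.src_eq.trans e₂.src_eq.symm
  rcases mul_eq_mul_cases src with ⟨m, hm, hm'⟩ | ⟨m, hm, hm'⟩
  · exact main e₁ e₂ h₁ h₂ m hm hm'
  · exact (main e₂ e₁ h₂ h₁ m hm hm').symm hE

end Homotopy

theorem IsNoetherian.wellFounded (h : IsNoetherian rels) :
    WellFounded fun v u => Step rels u v :=
  wellFounded_iff_isEmpty_descending_chain.2 ⟨fun f => h ⟨f.1, f.2⟩⟩

theorem IsNoetherian.exists_normalForm (h : IsNoetherian rels) (u : FreeMonoid A) :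
    ∃ t, (∀ v, ¬ Step rels t v) ∧ ∃ p : DPath rels u t, p.IsPos := by
  induction u using h.wellFounded.induction with
  | _ u ih =>
    by_cases hu : ∃ v, Step rels u v
    · obtain ⟨v, hv⟩ := hu
      obtain ⟨e, he⟩ := hv.exists_edge
      obtain ⟨t, ht, p, hp⟩ := ih v hv
      exact ⟨t, ht, .cons e p, he, hp⟩
    · exact ⟨u, fun v hv => hu ⟨v, hv⟩, .nil u, trivial⟩

theorem eq_of_irreducible {t v : FreeMonoid A} (ht : ∀ v, ¬ Step rels t v)
    (h : Relation.ReflTransGen (Step rels) t v) : t = v := by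
  rcases h.cases_head with h | ⟨w, hw, _⟩
  · exact h
  · exact absurd hw (ht w)

theorem IsConfluent.normalForm_unique (h : IsConfluent rels) {u t t' : FreeMonoid A}
    (ht : ∀ v, ¬ Step rels t v) (ht' : ∀ v, ¬ Step rels t' v)
    (hu : Relation.ReflTransGen (Step rels) u t) (hu' : Relation.ReflTransGen (Step rels) u t') :
    t = t' := by
  obtain ⟨v, hv, hv'⟩ := h u t t' hu hu'
  rw [eq_of_irreducible ht hv, eq_of_irreducible ht' hv']

theorem IsComplete.exists_isPos_of_path (hc : IsComplete rels) {u v t : FreeMonoid A}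
    (ht : ∀ v, ¬ Step rels t v) (p : DPath rels u v) (b : DPath rels v t) (hb : b.IsPos) :
    ∃ a : DPath rels u t, a.IsPos := by
  induction p with
  | nil => exact ⟨b, hb⟩
  | @cons u w v e p ih =>
    obtain ⟨c, hw⟩ := ih b hb
    cases he : e.pos with
    | true => exact ⟨.cons e c, he, hw⟩
    | false =>
      obtain ⟨t', ht', a, ha⟩ := hc.1.exists_normalForm u
      have he' : e.inv.pos = true := by simp [Edge.inv, he]
      obtain rfl : t' = t := hc.2.normalForm_unique ht' ht
        (ha.reflTransGen.head (e.inv.step he')) hw.reflTransGen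
      exact ⟨a, ha⟩

section Homotopy

variable {E : ∀ ⦃u v : FreeMonoid A⦄, DPath rels u v → DPath rels u v → Prop}

/-- Noetherian induction on the source: resolve the peak of the two first edges, continue the
resolution to the normal form, and apply the induction hypothesis after each first edge. -/
theorem homotopic_of_isPos (hE : IsHomotopyRelation rels E) (hc : IsComplete rels)
    (peaks : ∀ {u v₁ v₂ : FreeMonoid A} (e₁ : Edge rels u v₁) (e₂ : Edge rels u v₂),
      e₁.pos = true → e₂.pos = true → Joins E e₁ e₂)
    {u t : FreeMonoid A} (ht : ∀ v, ¬ Step rels t v) (p q : DPath rels u t) (hp : p.IsPos)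
    (hq : q.IsPos) : E p q := by
  induction u using hc.1.wellFounded.induction with
  | _ u ih =>
    cases p with
    | nil =>
      cases q with
      | nil => exact hE.refl _
      | cons e q => exact absurd (e.step hq.1) (ht _)
    | cons e₁ p =>
      cases q with
      | nil => exact absurd (e₁.step hp.1) (ht _)
      | cons e₂ q =>
        obtain ⟨s, p₁, p₂, h₁, h₂, h⟩ := peaks e₁ e₂ hp.1 hq.1
        obtain ⟨t', ht', r, hr⟩ := hc.1.exists_normalForm s
        obtain rfl : t = t' := hc.2.normalForm_unique ht ht' hp.2.reflTransGen
          (h₁.comp hr).reflTransGen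
        have a₁ := hE.cons e₁ (ih _ (e₁.step hp.1) p (p₁.comp r) hp.2 (h₁.comp hr))
        have a₂ := hE.cons e₂ (ih _ (e₂.step hq.1) q (p₂.comp r) hq.2 (h₂.comp hr))
        exact hE.trans a₁ (hE.trans (hE.comp_right h r) (hE.symm a₂))

theorem homotopic_of_parallel (hE : IsHomotopyRelation rels E) (hc : IsComplete rels)
    (peaks : ∀ {u v₁ v₂ : FreeMonoid A} (e₁ : Edge rels u v₁) (e₂ : Edge rels u v₂),
      e₁.pos = true → e₂.pos = true → Joins E e₁ e₂)
    {u v : FreeMonoid A} (p q : DPath rels u v) : E p q := by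
  -- Followed by a reduction to normal form, any path becomes homotopic to any reduction of its
  -- source. A backward edge is handled by cancelling it against its inverse. Two parallel paths are
  -- then compared by cancelling the reduction `b`.
  have key {u v t : FreeMonoid A} (ht : ∀ v, ¬ Step rels t v) (p : DPath rels u v)
      (a : DPath rels u t) (b : DPath rels v t) (ha : a.IsPos) (hb : b.IsPos) :
      E (p.comp b) a := by
    induction p with
    | nil => exact homotopic_of_isPos hE hc peaks ht b a hb ha
    | @cons u w v e p ih =>
      obtain ⟨t', ht', c, hw⟩ := hc.1.exists_normalForm w
      cases he : e.pos with
      | true =>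
        obtain rfl : t = t' := hc.2.normalForm_unique ht ht' ha.reflTransGen
          (hw.reflTransGen.head (e.step he))
        exact hE.trans (hE.cons e (ih c b hw hb))
          (homotopic_of_isPos hE hc peaks ht (.cons e c) a ⟨he, hw⟩ ha)
      | false =>
        have he' : e.inv.pos = true := by simp [Edge.inv, he]
        obtain rfl : t = t' := hc.2.normalForm_unique ht ht'
          (ha.reflTransGen.head (e.inv.step he')) hw.reflTransGen
        have h₁ := homotopic_of_isPos hE hc peaks ht c (.cons e.inv a) hw ⟨he', ha⟩
        exact hE.trans (hE.cons e (hE.trans (ih c b hw hb) h₁)) (hE.comp_right (hE.inv e.path) a)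
  obtain ⟨t, ht, b, hb⟩ := hc.1.exists_normalForm v
  obtain ⟨a, ha⟩ := hc.exists_isPos_of_path ht p b hb
  have h := hE.comp_right (hE.trans (key ht p a b ha hb) (hE.symm (key ht q a b ha hb))) b.inv
  rw [DPath.comp_assoc, DPath.comp_assoc] at h
  have e (r : DPath rels u v) : E (r.comp (b.comp b.inv)) r := by
    simpa using hE.comp_left r (hE.inv b)
  exact hE.trans (hE.symm (e p)) (hE.trans h (e q))

end Homotopy

theorem presentationHasFDT_of_isComplete [Finite A] (hfin : FiniteRules rels)
    (hc : IsComplete rels) : PresentationHasFDT rels := by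
  obtain ⟨K, hK⟩ : ∃ K : ℕ, ∀ l r, rels l r → l.length ≤ K := by
    obtain ⟨K, hK⟩ := (hfin.image fun r => r.1.length).bddAbove
    exact ⟨K, fun l r h => hK ⟨(l, r), h, rfl⟩⟩
  let S : Set (Σ u v₁ v₂ : FreeMonoid A, Edge rels u v₁ × Edge rels u v₂) :=
    {x | x.2.2.2.1.pos = true ∧ x.2.2.2.2.pos = true ∧ x.1.length ≤ K + K}
  have hS : S.Finite := by
    have hW : {w : FreeMonoid A | w.length ≤ K + K}.Finite := List.finite_length_le A (K + K)
    have hD := hW.prod (hfin.prod hW)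
    -- A peak is determined by the contexts and rules of its two edges, and these range over a
    -- finite set.
    refine Set.Finite.of_finite_image (f := fun x => ((x.2.2.2.1.left, x.2.2.2.1.rule,
      x.2.2.2.1.right), (x.2.2.2.2.left, x.2.2.2.2.rule, x.2.2.2.2.right)))
      ((hD.prod hD).subset ?_) ?_
    · rintro _ ⟨⟨u, v₁, v₂, e₁, e₂⟩, ⟨h₁, h₂, hu⟩, rfl⟩
      have le {v : FreeMonoid A} (e : Edge rels u v) (he : e.pos = true) :
          e.left.length ≤ K + K ∧ e.right.length ≤ K + K := by
        have := congrArg FreeMonoid.length e.src_eq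
        simp only [FreeMonoid.length_mul] at this
        dsimp only at hu
        omega
      exact ⟨⟨(le e₁ h₁).1, e₁.rule_mem, (le e₁ h₁).2⟩, (le e₂ h₂).1, e₂.rule_mem, (le e₂ h₂).2⟩
    · rintro ⟨u, v₁, v₂, ⟨l₁, r₁, _, s₁, hr₁, rfl, rfl⟩, ⟨l₂, r₂, _, s₂, hr₂, hs₂, rfl⟩⟩
        ⟨rfl, rfl, hu⟩
        ⟨u', v₁', v₂', ⟨l₁', r₁', _, s₁', hr₁', rfl, rfl⟩, ⟨l₂', r₂', _, s₂', hr₂', hs₂', rfl⟩⟩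
        ⟨rfl, rfl, hu'⟩ h
      simp only [Prod.mk.injEq] at h
      obtain ⟨⟨rfl, rfl, rfl⟩, rfl, rfl, rfl⟩ := h
      rfl
  have res (x : Σ u v₁ v₂ : FreeMonoid A, Edge rels u v₁ × Edge rels u v₂) (hx : x ∈ S) :
      ∃ (t : FreeMonoid A) (p₁ : DPath rels x.2.1 t) (p₂ : DPath rels x.2.2.1 t),
        p₁.IsPos ∧ p₂.IsPos := by
    obtain ⟨u, v₁, v₂, e₁, e₂⟩ := x
    obtain ⟨t, h₁, h₂⟩ := hc.2 u v₁ v₂ (.single (e₁.step hx.1)) (.single (e₂.step hx.2.1))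
    obtain ⟨p₁, hp₁⟩ := exists_isPos h₁
    obtain ⟨p₂, hp₂⟩ := exists_isPos h₂
    exact ⟨t, p₁, p₂, hp₁, hp₂⟩
  choose t p₁ p₂ hp₁ hp₂ using res
  let c (x : S) : ParallelPair rels :=
    ⟨_, _, .cons x.1.2.2.2.1 (p₁ x.1 x.2), .cons x.1.2.2.2.2 (p₂ x.1 x.2)⟩
  have := hS.to_subtype
  refine ⟨Set.range c, Set.finite_range c, fun u v p q E hE hC => ?_⟩
  refine homotopic_of_parallel hE hc (joins_of_short hE hK fun {u v₁ v₂} e₁ e₂ h₁ h₂ hu => ?_) p q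
  have hx : (⟨u, v₁, v₂, e₁, e₂⟩ : Σ u v₁ v₂ : FreeMonoid A, Edge rels u v₁ × Edge rels u v₂) ∈ S :=
    ⟨h₁, h₂, hu⟩
  exact ⟨_, _, _, hp₁ _ hx, hp₂ _ hx, hC (c ⟨_, hx⟩) ⟨_, rfl⟩⟩

theorem HasFiniteCompletePresentation.hasFDT {S : Type*} [Monoid S]
    (h : HasFiniteCompletePresentation S) : HasFDT S := by
  obtain ⟨A, rels, hA, hfin, hc, e⟩ := h
  exact ⟨A, rels, hA, hfin, e, presentationHasFDT_of_isComplete hfin hc⟩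

end MonoidRewriting

namespace MonoidRewriting

/-! ## A finite complete presentation of `N` -/

/-- The generators of a complete presentation of `N`: the letters `g y` of the free group,
the products `c y` of these letters with the idempotent `h`, the idempotent `h` and the zero. -/
inductive ExtGen
  | g (y : Bool × Bool)
  | c (y : Bool × Bool)
  | h
  | z

open FreeMonoid ExtGen

instance : Finite ExtGen := by
  refine Finite.of_surjective
    (fun x : (Bool × Bool) ⊕ (Bool × Bool) ⊕ Bool =>
      match x with
      | .inl y => g y
      | .inr (.inl y) => c y
      | .inr (.inr true) => h
      | .inr (.inr false) => z) ?_
  rintro (y | y | _ | _)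
  · exact ⟨.inl y, rfl⟩
  · exact ⟨.inr (.inl y), rfl⟩
  · exact ⟨.inr (.inr true), rfl⟩
  · exact ⟨.inr (.inr false), rfl⟩

/-- The rules of a complete presentation of `N`. -/
inductive ExtRel : FreeMonoid ExtGen → FreeMonoid ExtGen → Prop
  | g_inv (x s : Bool) : ExtRel (of (g (x, s)) * of (g (x, !s))) 1
  | g_h (y : Bool × Bool) : ExtRel (of (g y) * of h) (of (c y))
  | h_g (y : Bool × Bool) : ExtRel (of h * of (g y)) (of (c y))
  | g_c (x y : Bool × Bool) : ExtRel (of (g x) * of (c y)) (of (c x) * of (c y))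
  | c_g (x y : Bool × Bool) : ExtRel (of (c x) * of (g y)) (of (c x) * of (c y))
  | h_h : ExtRel (of h * of h) (of h)
  | h_c (y : Bool × Bool) : ExtRel (of h * of (c y)) (of (c y))
  | c_h (y : Bool × Bool) : ExtRel (of (c y) * of h) (of (c y))
  | c_inv (x s : Bool) : ExtRel (of (c (x, s)) * of (c (x, !s))) (of h)
  | swap (s t : Bool) :
      ExtRel (of (c (true, s)) * of (c (false, t))) (of (c (false, t)) * of (c (true, s)))
  | z_mul (x : ExtGen) : ExtRel (of z * of x) (of z)
  | mul_z (x : ExtGen) : ExtRel (of x * of z) (of z)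

theorem finiteRules_extRel : FiniteRules ExtRel := by
  have hW : {w : FreeMonoid ExtGen | w.length ≤ 2}.Finite := List.finite_length_le ExtGen 2
  refine (hW.prod hW).subset ?_
  rintro ⟨u, v⟩ huv
  cases huv <;> exact ⟨Nat.le_of_ble_eq_true rfl, Nat.le_of_ble_eq_true rfl⟩

/-- An interpretation of the letters by strictly increasing functions. -/
def ExtGen.act : ExtGen → ℕ → ℕ
  -- The value 2n + 1 makes a letter `g` outweigh each `c`. For `c`, doubling after adding one gives
  -- 2n + 2 and doubling before gives 2n + 1, which orients the rule `swap`.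
  | g _, n => 2 * n + 1
  | c (false, _), n => 2 * n
  | c (true, _), n => n + 1
  | h, n => n + 1
  | z, n => n + 1

/-- The value at `n` of the interpretation of a word. -/
def weight (w : FreeMonoid ExtGen) (n : ℕ) : ℕ := w.toList.foldl (fun n x => x.act n) n

theorem weight_mul (u v : FreeMonoid ExtGen) (n : ℕ) : weight (u * v) n = weight v (weight u n) := by
  simp [weight]

theorem weight_of (x : ExtGen) (n : ℕ) : weight (of x) n = x.act n := rfl

theorem act_strictMono (x : ExtGen) : StrictMono x.act := by
  intro m n hmn
  rcases x with _ | ⟨_ | _, _⟩ | _ | _ <;> simp only [ExtGen.act] <;> omega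

theorem weight_strictMono (w : FreeMonoid ExtGen) : StrictMono (weight w) := by
  induction w using FreeMonoid.inductionOn' with
  | one => exact strictMono_id
  | of_mul x w ih => exact ih.comp (act_strictMono x)

theorem weight_pos (w : FreeMonoid ExtGen) {n : ℕ} (hn : 1 ≤ n) : 1 ≤ weight w n :=
  hn.trans (weight_strictMono w).le_apply

/-- The bound `1 ≤ n` matters because doubling does not increase 0. Evaluating at 1 and using strict
monotonicity of the right context turns this into termination. -/
theorem weight_rel {u v : FreeMonoid ExtGen} (huv : ExtRel u v) {n : ℕ} (hn : 1 ≤ n) :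
    weight v n < weight u n := by
  have inflate (x : ExtGen) {m : ℕ} (hm : 1 ≤ m) : m < x.act m := by
    rcases x with _ | ⟨_ | _, _⟩ | _ | _ <;> simp only [ExtGen.act] <;> omega
  cases huv with
  | z_mul x => exact inflate x (by simp [weight_of, ExtGen.act])
  | mul_z x => exact act_strictMono z (inflate x hn)
  | g_inv =>
    change n < _
    simp only [weight_mul, weight_of, ExtGen.act]
    omega
  | g_h y => rcases y with ⟨_ | _, _⟩ <;> simp only [weight_mul, weight_of, ExtGen.act] <;> omega
  | h_g y => rcases y with ⟨_ | _, _⟩ <;> simp only [weight_mul, weight_of, ExtGen.act] <;> omega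
  | g_c x y =>
    rcases x with ⟨_ | _, _⟩ <;> rcases y with ⟨_ | _, _⟩ <;>
      simp only [weight_mul, weight_of, ExtGen.act] <;> omega
  | c_g x y =>
    rcases x with ⟨_ | _, _⟩ <;> rcases y with ⟨_ | _, _⟩ <;>
      simp only [weight_mul, weight_of, ExtGen.act] <;> omega
  | h_h => simp only [weight_mul, weight_of, ExtGen.act]; omega
  | h_c y => rcases y with ⟨_ | _, _⟩ <;> simp only [weight_mul, weight_of, ExtGen.act] <;> omega
  | c_h y => rcases y with ⟨_ | _, _⟩ <;> simp only [weight_mul, weight_of, ExtGen.act] <;> omega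
  | c_inv x s => cases x <;> simp only [weight_mul, weight_of, ExtGen.act] <;> omega
  | swap s t => simp only [weight_mul, weight_of, ExtGen.act]; omega

theorem isNoetherian_extRel : IsNoetherian ExtRel := by
  rintro ⟨f, hf⟩
  have anti (n : ℕ) : weight (f (n + 1)) 1 < weight (f n) 1 := by
    obtain ⟨w₁, l, r, w₂, hlr, e, e'⟩ := hf n
    rw [e, e', weight_mul, weight_mul, weight_mul, weight_mul]
    exact weight_strictMono w₂ (weight_rel hlr (weight_pos w₁ le_rfl))
  exact not_strictAnti_of_wellFoundedLT _
    (strictAnti_nat_of_succ_lt (f := fun n => weight (f n) 1) anti)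

/-- The element of the model represented by a letter. -/
def ExtGen.model : ExtGen → Model true
  | g y => .grp (.mk [y])
  | c y => .ab (expSum (.mk [y]))
  | h => .ab 1
  | z => .zero

/-- The element of the model represented by a word. -/
def ExtGen.eval : FreeMonoid ExtGen →* Model true := FreeMonoid.lift ExtGen.model

theorem freeGroup_mk_inv (x s : Bool) :
    (FreeGroup.mk [(x, s)] * FreeGroup.mk [(x, !s)] : FreeGroup Bool) = 1 := by
  rw [FreeGroup.mul_mk, FreeGroup.one_eq_mk]
  exact Quot.sound (FreeGroup.Red.Step.not (L₁ := []) (L₂ := []))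

theorem eval_rel {u v : FreeMonoid ExtGen} (huv : ExtRel u v) : eval u = eval v := by
  cases huv with
  | g_inv x s => exact congrArg Layered.grp (freeGroup_mk_inv x s)
  | c_inv x s =>
    exact congrArg Layered.ab ((map_mul expSum _ _).symm.trans (by rw [freeGroup_mk_inv, map_one]))
  | swap => simp [eval, ExtGen.model, mul_comm]
  | _ => simp [eval, ExtGen.model]

theorem eval_step {u v : FreeMonoid ExtGen} (huv : Step ExtRel u v) : eval u = eval v := by
  obtain ⟨w₁, l, r, w₂, hlr, rfl, rfl⟩ := huv
  rw [map_mul, map_mul, map_mul, map_mul, eval_rel hlr]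

/-- Reduction by the rules of the complete presentation. -/
local infix:50 " ⟶* " => Relation.ReflTransGen (Step ExtRel)

theorem eval_reduces {u v : FreeMonoid ExtGen} (huv : u ⟶* v) : eval u = eval v := by
  induction huv with
  | refl => rfl
  | tail _ h ih => exact ih.trans (eval_step h)

theorem reduces_mul (x y : FreeMonoid ExtGen) {u v : FreeMonoid ExtGen} (huv : u ⟶* v) :
    x * u * y ⟶* x * v * y := by
  refine huv.lift (fun t => x * t * y) ?_
  rintro _ _ ⟨w₁, l, r, w₂, hlr, rfl, rfl⟩
  exact ⟨x * w₁, l, r, w₂ * y, hlr, by simp only [mul_assoc], by simp only [mul_assoc]⟩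

theorem reduces_mul_left (x : FreeMonoid ExtGen) {u v : FreeMonoid ExtGen} (huv : u ⟶* v) :
    x * u ⟶* x * v := by
  simpa using reduces_mul x 1 huv

theorem reduces_rel {u v : FreeMonoid ExtGen} (huv : ExtRel u v) (x y : FreeMonoid ExtGen) :
    x * u * y ⟶* x * v * y := .single ⟨x, u, v, y, huv, rfl, rfl⟩

theorem reduces_rel_right {u v : FreeMonoid ExtGen} (huv : ExtRel u v) (y : FreeMonoid ExtGen) :
    u * y ⟶* v * y := by
  simpa using reduces_rel huv 1 y

theorem reduces_rel_self {u v : FreeMonoid ExtGen} (huv : ExtRel u v) : u ⟶* v := by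
  simpa using reduces_rel huv 1 1

/-- The word in the letters `g y` given by a list. -/
def gWord (L : List (Bool × Bool)) : FreeMonoid ExtGen := ofList (L.map g)

/-- The word in the letters `c y` given by a list. -/
def cWord (L : List (Bool × Bool)) : FreeMonoid ExtGen := ofList (L.map c)

/-- The word in the letters `c y` given by a list, or `h` if the list is empty. -/
def hWord : List (Bool × Bool) → FreeMonoid ExtGen
  | [] => of h
  | y :: L => of (c y) * cWord L

theorem gWord_cons (y : Bool × Bool) (L : List (Bool × Bool)) :
    gWord (y :: L) = of (g y) * gWord L := rfl

theorem cWord_cons (y : Bool × Bool) (L : List (Bool × Bool)) :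
    cWord (y :: L) = of (c y) * cWord L := rfl

theorem gWord_append (L L' : List (Bool × Bool)) : gWord (L ++ L') = gWord L * gWord L' := by
  simp [gWord]

theorem cWord_append (L L' : List (Bool × Bool)) : cWord (L ++ L') = cWord L * cWord L' := by
  simp [cWord]

theorem c_mul_hWord (y : Bool × Bool) (L : List (Bool × Bool)) :
    of (c y) * hWord L ⟶* hWord (y :: L) := by
  cases L with
  | nil => exact reduces_rel_self (.c_h y)
  | cons x L => exact .refl

theorem h_mul_hWord (L : List (Bool × Bool)) : of h * hWord L ⟶* hWord L := by
  cases L with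
  | nil => exact reduces_rel_self .h_h
  | cons x L => exact reduces_rel_right (.h_c x) (cWord L)

theorem g_mul_hWord (y : Bool × Bool) (L : List (Bool × Bool)) :
    of (g y) * hWord L ⟶* hWord (y :: L) := by
  cases L with
  | nil => exact reduces_rel_self (.g_h y)
  | cons x L => exact reduces_rel_right (.g_c y x) (cWord L)

/-- For `L = []` the word `hWord [y]` has no factor h to which the given reduction could be applied.
-/
theorem hWord_cons_congr (y : Bool × Bool) {L L' : List (Bool × Bool)} (hL : L ≠ [])
    (h : hWord L ⟶* hWord L') : hWord (y :: L) ⟶* hWord (y :: L') := by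
  cases L with
  | nil => exact absurd rfl hL
  | cons x L => exact (reduces_mul_left (of (c y)) h).trans (c_mul_hWord y L')

/-- Cancelling an inverse pair of letters `c` leaves an h in the middle; a neighbouring `c` absorbs
it, and it survives only when both lists are empty. -/
theorem cWord_h_cWord (L L' : List (Bool × Bool)) :
    cWord L * (of h * cWord L') ⟶* hWord (L ++ L') := by
  induction L with
  | nil =>
    cases L' with
    | nil => exact .refl
    | cons x L' => exact reduces_rel_right (.h_c x) (cWord L')
  | cons y L ih => exact (reduces_mul_left (of (c y)) ih).trans (c_mul_hWord y (L ++ L'))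

theorem hWord_red {L L' : List (Bool × Bool)} (h : FreeGroup.Red L L') : hWord L ⟶* hWord L' := by
  induction h with
  | refl => exact .refl
  | tail _ h ih =>
    refine ih.trans ?_
    obtain @⟨L₁, L₂, x, s⟩ := h
    have e : hWord (L₁ ++ (x, s) :: (x, !s) :: L₂) =
        cWord L₁ * (of (c (x, s)) * of (c (x, !s))) * cWord L₂ := by
      cases L₁ with
      | nil => rfl
      | cons y L₁ => simp only [hWord, List.cons_append, cWord_append, cWord_cons, mul_assoc]
    rw [e]
    refine (reduces_rel (.c_inv x s) _ _).trans ?_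
    rw [mul_assoc]
    exact cWord_h_cWord L₁ L₂

theorem gWord_red {L L' : List (Bool × Bool)} (h : FreeGroup.Red L L') : gWord L ⟶* gWord L' := by
  induction h with
  | refl => exact .refl
  | tail _ h ih =>
    refine ih.trans ?_
    obtain @⟨L₁, L₂, x, s⟩ := h
    rw [gWord_append, gWord_append, gWord_cons, gWord_cons, ← mul_assoc (of _)]
    simpa [mul_assoc] using reduces_rel (.g_inv x s) (gWord L₁) (gWord L₂)

/-- The reduced word for the `i`-th power of the generator `x`. -/
def powList (x : Bool) (i : ℤ) : List (Bool × Bool) := List.replicate i.natAbs (x, decide (0 ≤ i))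

theorem powList_natCast (x : Bool) (n : ℕ) : powList x n = List.replicate n (x, true) := by
  simp [powList]

theorem powList_neg_natCast (x : Bool) (n : ℕ) : powList x (-n) = List.replicate n (x, false) := by
  cases n with
  | zero => rfl
  | succ n =>
    have h : ¬ (0 : ℤ) ≤ -((n + 1 : ℕ) : ℤ) := by omega
    simp only [powList, Int.natAbs_neg, Int.natAbs_natCast, h, decide_false]

theorem red_cons_powList (x s : Bool) (i : ℤ) :
    FreeGroup.Red ((x, s) :: powList x i) (powList x ((if s then 1 else -1) + i)) := by
  obtain ⟨n, rfl | rfl⟩ := i.eq_nat_or_neg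
  · cases s with
    | true =>
      have e : (if true then 1 else -1) + (n : ℤ) = (n + 1 : ℕ) := by simp [add_comm]
      rw [e, powList_natCast, powList_natCast]
      exact .refl
    | false =>
      cases n with
      | zero => exact .refl
      | succ n =>
        have e : (if false then 1 else -1) + ((n + 1 : ℕ) : ℤ) = n := by simp
        rw [e, powList_natCast, powList_natCast]
        exact FreeGroup.Red.Step.cons_not.to_red
  · cases s with
    | true =>
      cases n with
      | zero => exact .refl
      | succ n =>
        have e : (if true then 1 else -1) + -((n + 1 : ℕ) : ℤ) = -n := by simp
        rw [e, powList_neg_natCast, powList_neg_natCast]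
        exact FreeGroup.Red.Step.cons_not.to_red
    | false =>
      have e : (if false then 1 else -1) + -(n : ℤ) = -((n + 1 : ℕ) : ℤ) := by simp
      rw [e, powList_neg_natCast, powList_neg_natCast]
      exact .refl

theorem hWord_swap (s t : Bool) (n : ℕ) (L : List (Bool × Bool)) :
    hWord ((true, s) :: (List.replicate n (false, t) ++ L)) ⟶*
      hWord (List.replicate n (false, t) ++ (true, s) :: L) := by
  induction n with
  | zero => exact .refl
  | succ n ih =>
    refine (reduces_rel_right (.swap s t) (cWord (List.replicate n (false, t) ++ L))).trans ?_
    exact hWord_cons_congr (false, t) (by simp) ih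

/-- The reduced list representing an element of the free abelian group. -/
def abList (α : Multiplicative ℤ × Multiplicative ℤ) : List (Bool × Bool) :=
  powList false α.1.toAdd ++ powList true α.2.toAdd

/-- The normal form of an element of the model. -/
def normalForm : Model true → FreeMonoid ExtGen
  | .grp x => gWord x.toWord
  | .ab α => hWord (abList α)
  | .zero => of z

theorem hWord_cons_abList (y : Bool × Bool) (α : Multiplicative ℤ × Multiplicative ℤ) :
    hWord (y :: abList α) ⟶* hWord (abList (expSum (.mk [y]) * α)) := by
  obtain ⟨x, s⟩ := y
  have e : expSum (.mk [(x, s)]) =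
      if x then (1, .ofAdd (if s then 1 else -1)) else (.ofAdd (if s then 1 else -1), 1) := by
    cases x <;> cases s <;> simp [expSum]
  rw [e]
  cases x with
  | false =>
    have := hWord_red ((red_cons_powList false s α.1.toAdd).append_append
      (.refl (L := powList true α.2.toAdd)))
    simpa [abList] using this
  | true =>
    refine (hWord_swap s _ _ _).trans ?_
    have := hWord_red (FreeGroup.Red.append_append (.refl (L := powList false α.1.toAdd))
      (red_cons_powList true s α.2.toAdd))
    simpa [abList, powList] using this

theorem c_mul_gWord (y : Bool × Bool) (L : List (Bool × Bool)) :
    of (c y) * gWord L ⟶* hWord (abList (expSum (.mk (y :: L)))) := by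
  induction L generalizing y with
  | nil => simpa using! hWord_cons_abList y 1
  | cons x L ih =>
    refine (reduces_rel_right (.c_g y x) (gWord L)).trans ?_
    rw [mul_assoc]
    refine (reduces_mul_left _ (ih x)).trans ((c_mul_hWord _ _).trans ?_)
    refine (hWord_cons_abList _ _).trans ?_
    rw [← map_mul, FreeGroup.mul_mk]
    exact .refl

theorem z_mul_reduces (w : FreeMonoid ExtGen) : of z * w ⟶* of z := by
  induction w using FreeMonoid.inductionOn' with
  | one => exact .refl
  | of_mul x w ih =>
    rw [← mul_assoc]
    exact (reduces_rel_right (.z_mul x) w).trans ih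

/-- With this, a word is brought to normal form letter by letter from the right. -/
theorem of_mul_normalForm (x : ExtGen) (m : Model true) :
    of x * normalForm m ⟶* normalForm (x.model * m) := by
  cases m with
  | zero =>
    rw [Layered.mul_zero']
    exact reduces_rel_self (.mul_z x)
  | grp t =>
    cases x with
    | g y =>
      have : (FreeGroup.mk [y] * t).toWord = FreeGroup.reduce (y :: t.toWord) := by
        conv_lhs => rw [← FreeGroup.mk_toWord (x := t), FreeGroup.mul_mk, FreeGroup.toWord_mk]
        rfl
      rw [ExtGen.model, Layered.grp_mul_grp, normalForm, normalForm, this]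
      exact gWord_red (FreeGroup.reduce.red (L := y :: t.toWord))
    | c y =>
      have := c_mul_gWord y t.toWord
      rwa [← List.singleton_append, ← FreeGroup.mul_mk, FreeGroup.mk_toWord, map_mul] at this
    | h =>
      rw [ExtGen.model, Layered.ab_mul_grp, one_mul, normalForm, normalForm,
        ← FreeGroup.mk_toWord (x := t), FreeGroup.toWord_mk, FreeGroup.reduce_toWord]
      cases t.toWord with
      | nil => exact .refl
      | cons y L => exact (reduces_rel_right (.h_g y) (gWord L)).trans (c_mul_gWord y L)
    | z => exact z_mul_reduces _
  | ab α =>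
    cases x with
    | g y => exact (g_mul_hWord _ _).trans (hWord_cons_abList y α)
    | c y => exact (c_mul_hWord _ _).trans (hWord_cons_abList y α)
    | h =>
      rw [ExtGen.model, Layered.ab_mul_ab, if_pos rfl, one_mul]
      exact h_mul_hWord _
    | z => exact z_mul_reduces _

theorem reduces_normalForm (w : FreeMonoid ExtGen) : w ⟶* normalForm (eval w) := by
  induction w using FreeMonoid.inductionOn' with
  | one => exact .refl
  | of_mul x w ih =>
    rw [map_mul]
    exact (reduces_mul_left _ ih).trans (of_mul_normalForm x _)

/-- No critical pairs are examined: reduction preserves `eval`, and each word reduces to a normal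
form that depends only on its value. -/
theorem isConfluent_extRel : IsConfluent ExtRel := fun w u v hu hv =>
  ⟨normalForm (eval w), eval_reduces hu ▸ reduces_normalForm u,
    eval_reduces hv ▸ reduces_normalForm v⟩

theorem mk_eq_mk_of_step {B : Type*} {rels : FreeMonoid B → FreeMonoid B → Prop}
    {u v : FreeMonoid B} (h : Step rels u v) :
    PresentedMonoid.mk rels u = PresentedMonoid.mk rels v := by
  obtain ⟨w₁, l, r, w₂, hlr, rfl, rfl⟩ := h
  simp only [map_mul, PresentedMonoid.mk_eq_mk_of_rel hlr]

theorem mk_eq_mk_of_reduces {u v : FreeMonoid ExtGen} (h : u ⟶* v) :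
    PresentedMonoid.mk ExtRel u = PresentedMonoid.mk ExtRel v := by
  induction h with
  | refl => rfl
  | tail _ h ih => exact ih.trans (mk_eq_mk_of_step h)

theorem eval_surjective : Function.Surjective eval := by
  rw [← MonoidHom.mrange_eq_top, eq_top_iff, ← closure_range_model, Submonoid.closure_le]
  rintro _ ⟨_ | _ | _ | _ | _ | _, rfl⟩
  · exact ⟨of (g (false, true)), rfl⟩
  · exact ⟨of (g (false, false)), rfl⟩
  · exact ⟨of (g (true, true)), rfl⟩
  · exact ⟨of (g (true, false)), rfl⟩
  · exact ⟨of h, rfl⟩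
  · exact ⟨of z, rfl⟩

theorem hasFiniteCompletePresentation_N : HasFiniteCompletePresentation (PresentedMonoid NRel) := by
  refine ⟨ExtGen, ExtRel, inferInstance, finiteRules_extRel,
    ⟨isNoetherian_extRel, isConfluent_extRel⟩, ⟨equivN.trans (MulEquiv.symm ?_)⟩⟩
  refine MulEquiv.ofBijective (PresentedMonoid.lift ExtGen.model fun _ _ => eval_rel) ⟨?_, ?_⟩
  · intro p q
    induction p with | _ u
    induction q with | _ v
    intro huv
    change eval u = eval v at huv
    rw [mk_eq_mk_of_reduces (reduces_normalForm u), huv,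
      ← mk_eq_mk_of_reduces (reduces_normalForm v)]
  · intro m
    obtain ⟨w, rfl⟩ := eval_surjective m
    exact ⟨PresentedMonoid.mk ExtRel w, rfl⟩

end MonoidRewriting

namespace MonoidRewriting

/-! ## The wreath product of two infinite cyclic groups -/

/-- The wreath product of two infinite cyclic groups. -/
@[ext]
structure Lamp where
  lamps : ℤ →₀ ℤ
  pos : ℤ

/-- The translation by `m` of a finitely supported function on `ℤ`. -/
noncomputable def shift (m : ℤ) : (ℤ →₀ ℤ) →+ (ℤ →₀ ℤ) := Finsupp.mapDomain.addMonoidHom (m + ·)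

theorem shift_zero (f : ℤ →₀ ℤ) : shift 0 f = f := by
  change Finsupp.mapDomain (0 + ·) f = f
  rw [show ((0 : ℤ) + ·) = id from funext zero_add, Finsupp.mapDomain_id]

theorem shift_add (m n : ℤ) (f : ℤ →₀ ℤ) : shift (m + n) f = shift m (shift n f) := by
  change Finsupp.mapDomain _ f = Finsupp.mapDomain _ (Finsupp.mapDomain _ f)
  rw [← Finsupp.mapDomain_comp]
  congr 1
  funext i
  exact add_assoc m n i

theorem shift_apply (m : ℤ) (f : ℤ →₀ ℤ) (i : ℤ) : shift m f i = f (i - m) := by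
  have h := Finsupp.mapDomain_apply (add_right_injective m) f (i - m)
  rwa [add_sub_cancel] at h

theorem shift_single (m i k : ℤ) : shift m (Finsupp.single i k) = Finsupp.single (m + i) k :=
  Finsupp.mapDomain_single

theorem shift_injective (m : ℤ) : Function.Injective (shift m) :=
  Finsupp.mapDomain_injective (add_right_injective m)

namespace Lamp

noncomputable instance : One Lamp := ⟨⟨0, 0⟩⟩
noncomputable instance : Mul Lamp := ⟨fun x y => ⟨x.lamps + shift x.pos y.lamps, x.pos + y.pos⟩⟩
noncomputable instance : Inv Lamp := ⟨fun x => ⟨-shift (-x.pos) x.lamps, -x.pos⟩⟩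

@[simp] theorem one_lamps : (1 : Lamp).lamps = 0 := rfl
@[simp] theorem one_pos : (1 : Lamp).pos = 0 := rfl
@[simp] theorem mul_lamps (x y : Lamp) : (x * y).lamps = x.lamps + shift x.pos y.lamps := rfl
@[simp] theorem mul_pos (x y : Lamp) : (x * y).pos = x.pos + y.pos := rfl
@[simp] theorem inv_lamps (x : Lamp) : x⁻¹.lamps = -shift (-x.pos) x.lamps := rfl
@[simp] theorem inv_pos (x : Lamp) : x⁻¹.pos = -x.pos := rfl

noncomputable instance : Group Lamp :=
  Group.ofLeftAxioms
    (fun x y z => by ext1 <;> simp [shift_add, add_assoc])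
    (fun x => by ext1 <;> simp [shift_zero])
    (fun x => by ext1 <;> simp)

/-- The elements with trivial position and lamps in the interval from `-n` to `n`. -/
def box (n : ℕ) : Subgroup Lamp where
  carrier := {x | x.pos = 0 ∧ ∀ i : ℤ, n < i.natAbs → x.lamps i = 0}
  one_mem' := ⟨rfl, fun _ _ => rfl⟩
  mul_mem' := by
    rintro x y ⟨hx, hx'⟩ ⟨hy, hy'⟩
    exact ⟨by simp [hx, hy], fun i hi => by simp [hx, shift_zero, hx' i hi, hy' i hi]⟩
  inv_mem' := by
    rintro x ⟨hx, hx'⟩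
    exact ⟨by simp [hx], fun i hi => by simp [hx, shift_zero, hx' i hi]⟩

theorem mem_box {n : ℕ} {x : Lamp} :
    x ∈ box n ↔ x.pos = 0 ∧ ∀ i : ℤ, n < i.natAbs → x.lamps i = 0 := Iff.rfl

/-- The wreath product acts by translations on `ℤ`. -/
noncomputable instance : MulAction Lamp ℤ where
  smul x i := x.pos + i
  one_smul i := zero_add i
  mul_smul x y i := add_assoc x.pos y.pos i

end Lamp

/-- The action of a group on the finitely supported functions on a set on which it acts. -/
noncomputable def translate {G X : Type*} [Group G] [MulAction G X] (x : G) :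
    (X →₀ ℤ) →+ (X →₀ ℤ) := Finsupp.mapDomain.addMonoidHom (x • ·)

section Translate

variable {G X Y : Type*} [Group G] [MulAction G X] [MulAction G Y]

theorem translate_one (F : X →₀ ℤ) : translate (1 : G) F = F := by
  change Finsupp.mapDomain ((1 : G) • ·) F = F
  rw [show ((1 : G) • · : X → X) = id from funext (one_smul G), Finsupp.mapDomain_id]

theorem translate_mul (x y : G) (F : X →₀ ℤ) :
    translate (x * y) F = translate x (translate y F) := by
  change Finsupp.mapDomain _ F = Finsupp.mapDomain _ (Finsupp.mapDomain _ F)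
  rw [← Finsupp.mapDomain_comp]
  congr 1
  funext i
  exact mul_smul x y i

theorem translate_apply (x : G) (F : X →₀ ℤ) (i : X) : translate x F (x • i) = F i :=
  Finsupp.mapDomain_apply (MulAction.injective x) F i

theorem mapDomain_translate (f : X → Y) (hf : ∀ (x : G) i, f (x • i) = x • f i) (x : G)
    (F : X →₀ ℤ) : Finsupp.mapDomain f (translate x F) = translate x (Finsupp.mapDomain f F) := by
  change Finsupp.mapDomain _ (Finsupp.mapDomain _ F) = Finsupp.mapDomain _ (Finsupp.mapDomain _ F)
  rw [← Finsupp.mapDomain_comp, ← Finsupp.mapDomain_comp]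
  congr 1
  funext i
  exact hf x i

end Translate

/-- The base points of the cosets of `Lamp.box n`. -/
noncomputable def boxPoint (n : ℕ) (m : ℤ) : Lamp ⧸ Lamp.box n := ((⟨0, m⟩ : Lamp) : Lamp ⧸ _)

/-- The position of a coset of `Lamp.box n`. -/
noncomputable def boxPos (n : ℕ) : Lamp ⧸ Lamp.box n → ℤ :=
  Quotient.lift Lamp.pos fun x y h => by
    have := (QuotientGroup.leftRel_apply.1 h).1
    simp only [Lamp.mul_pos, Lamp.inv_pos] at this
    omega

theorem boxPos_smul (n : ℕ) (x : Lamp) (i : Lamp ⧸ Lamp.box n) :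
    boxPos n (x • i) = x • boxPos n i := by
  induction i using QuotientGroup.induction_on with
  | H y => rfl

/-- Seen from its position, all lamps of `x` lie in the box, so `x` is `⟨0, x.pos⟩` times an element
of the box. -/
theorem mk_eq_boxPoint {n : ℕ} {x : Lamp} (h : ∀ i ∈ x.lamps.support, (i - x.pos).natAbs ≤ n) :
    (x : Lamp ⧸ Lamp.box n) = boxPoint n x.pos := by
  refine (QuotientGroup.eq.2 (Lamp.mem_box.2 ⟨by simp, fun i hi => ?_⟩)).symm
  by_contra hne
  simp only [Lamp.mul_lamps, Lamp.inv_lamps, Lamp.inv_pos, map_zero, neg_zero, zero_add,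
    shift_apply, sub_neg_eq_add] at hne
  have := h _ (Finsupp.mem_support_iff.2 hne)
  rw [add_sub_cancel_right] at this
  omega

/-- Finitely many elements involve finitely many lamps, so for large `n` the quotient map factors
through `Lamp.pos` on the support of `F`. -/
theorem eventually_mapDomain_mk_eq_zero {F : Lamp →₀ ℤ} (hF : F.mapDomain Lamp.pos = 0) :
    ∃ N : ℕ, ∀ n ≥ N, F.mapDomain ((↑) : Lamp → Lamp ⧸ Lamp.box n) = 0 := by
  refine ⟨F.support.sup fun x => x.lamps.support.sup fun i => (i - x.pos).natAbs, fun n hn => ?_⟩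
  have e : F.mapDomain ((↑) : Lamp → Lamp ⧸ Lamp.box n) = F.mapDomain (boxPoint n ∘ Lamp.pos) := by
    refine Finsupp.mapDomain_congr fun x hx => mk_eq_boxPoint fun i hi => ?_
    refine le_trans (le_trans ?_ (Finset.le_sup
      (f := fun x : Lamp => x.lamps.support.sup fun i => (i - x.pos).natAbs) hx)) hn
    exact Finset.le_sup (f := fun i : ℤ => (i - x.pos).natAbs) hi
  rw [e, Finsupp.mapDomain_comp, hF, Finsupp.mapDomain_zero]

/-- The elements of the derived subgroup that switch two lamps. -/
noncomputable def lampPair (j : ℤ) : Lamp := ⟨Finsupp.single j 1 - Finsupp.single 0 1, 0⟩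

/-- An invariant element would have infinitely many cosets in its finite support. -/
theorem eq_zero_of_translate_eq {n : ℕ} {F : Lamp ⧸ Lamp.box n →₀ ℤ}
    (h : ∀ j, translate (lampPair j) F = F) : F = 0 := by
  by_contra hne
  obtain ⟨x, hx⟩ := Finsupp.ne_iff.1 hne
  induction x using QuotientGroup.induction_on with
  | H x =>
    have mem (j : ℤ) : lampPair j • (x : Lamp ⧸ Lamp.box n) ∈ F.support := by
      rw [Finsupp.mem_support_iff, ← h j, translate_apply]
      exact hx
    -- Conjugation by `x` moves the lamp at this index to `n + 1 + i`, just outside the box, so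
    -- different `i` give different cosets.
    let φ (i : ℕ) : F.support := ⟨_, mem (x.pos + n + 1 + i)⟩
    have hφ : Function.Injective φ := by
      intro i j hij
      by_contra hne
      have e : ((lampPair (x.pos + n + 1 + i) * x : Lamp) : Lamp ⧸ Lamp.box n) =
        ((lampPair (x.pos + n + 1 + j) * x : Lamp) : Lamp ⧸ Lamp.box n) := congrArg Subtype.val hij
      have := (Lamp.mem_box.1 (QuotientGroup.eq.1 e)).2 (n + 1 + i) (by omega)
      have h₁ : x.pos + n + 1 + (j : ℤ) ≠ n + 1 + i + x.pos := by omega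
      have h₂ : x.pos + n + 1 + (i : ℤ) = n + 1 + i + x.pos := by omega
      simp [lampPair, shift_apply, shift_zero, Finsupp.single_apply, h₁, h₂] at this
      linarith
    exact not_injective_infinite_finite φ hφ

/-- The homomorphism of the free group onto the wreath product. -/
noncomputable def freeToLamp : FreeGroup Bool →* Lamp :=
  FreeGroup.lift fun x => if x then ⟨0, 1⟩ else ⟨Finsupp.single 0 1, 0⟩

theorem freeToLamp_pos (g : FreeGroup Bool) : (freeToLamp g).pos = (expSum g).2.toAdd := by
  induction g using freeGroup_induction with
  | one => simp
  | gens x => cases x <;> simp [freeToLamp, expSum]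
  | mul g g' h h' => simp [h, h']

theorem exists_freeToLamp_eq (j : ℤ) :
    ∃ g, expSum g = 1 ∧ freeToLamp g = lampPair j := by
  have hpow (j : ℤ) : freeToLamp (.of true ^ j) = ⟨0, j⟩ := by
    have h₁ (j : ℤ) : (freeToLamp (.of true ^ j)).pos = j := by
      rw [freeToLamp_pos, map_zpow, expSum_of]
      simp
    have h₂ : (freeToLamp (.of true ^ j)).lamps = 0 := by
      induction j using Int.induction_on with
      | zero => simp
      | succ i ih =>
        rw [zpow_add, map_mul, Lamp.mul_lamps, ih]
        simp [freeToLamp]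
      | pred i ih =>
        rw [zpow_sub, map_mul, Lamp.mul_lamps, ih]
        simp [freeToLamp]
    exact Lamp.ext h₂ (h₁ j)
  -- The commutator of bʲ and a switches the lamp at j up and the lamp at 0 down.
  refine ⟨.of true ^ j * .of false * .of true ^ (-j) * (.of false)⁻¹, ?_, ?_⟩
  · simp [expSum_of]
  · rw [map_mul, map_mul, map_mul, hpow, hpow]
    ext1 <;> simp [freeToLamp, lampPair, shift_single, shift_zero, sub_eq_add_neg]

end MonoidRewriting

namespace MonoidRewriting

/-! ## `M` does not have finite derivation type -/

/-! ### Values of paths in permutation modules of the wreath product. -/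

section PathValue

variable {A : Type*} {rels : FreeMonoid A → FreeMonoid A → Prop} {X : Type*} [MulAction Lamp X]

/-- The left-hand side of the rule of an edge, in the direction in which it is applied. -/
def Edge.ruleSrc {u v : FreeMonoid A} (e : Edge rels u v) : FreeMonoid A :=
  if e.pos = true then e.rule.1 else e.rule.2

/-- The right-hand side of the rule of an edge, in the direction in which it is applied. -/
def Edge.ruleTgt {u v : FreeMonoid A} (e : Edge rels u v) : FreeMonoid A :=
  if e.pos = true then e.rule.2 else e.rule.1

/-- The value of an edge under a homomorphism `lam` to the wreath product. -/
noncomputable def Edge.value (lam : FreeMonoid A →* Lamp) (s : ℤ → X) {u v : FreeMonoid A}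
    (e : Edge rels u v) : X →₀ ℤ :=
  -- The right context is ignored: its lamps are moved only by the position of what precedes it,
  -- which the rules that matter preserve. The map `s` says where a lamp index is recorded in `X`.
  translate (lam e.left) (Finsupp.mapDomain s ((lam e.ruleSrc).lamps - (lam e.ruleTgt).lamps))

/-- The sum of the values of the edges of a path. -/
noncomputable def DPath.value (lam : FreeMonoid A →* Lamp) (s : ℤ → X) :
    ∀ {u v : FreeMonoid A}, DPath rels u v → (X →₀ ℤ)
  | _, _, .nil _ => 0
  | _, _, .cons e p => e.value lam s + p.value lam s

variable (lam : FreeMonoid A →* Lamp) (s : ℤ → X) {u v w : FreeMonoid A}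

theorem Edge.value_inv (e : Edge rels u v) : e.inv.value lam s = -e.value lam s := by
  rw [Edge.value, Edge.value, ← map_neg]
  have : (lam e.inv.ruleSrc).lamps - (lam e.inv.ruleTgt).lamps =
      -((lam e.ruleSrc).lamps - (lam e.ruleTgt).lamps) := by
    cases h : e.pos <;> simp [Edge.inv, ruleSrc, ruleTgt, h]
  rw [this]
  exact congrArg (translate _) (map_neg (Finsupp.mapDomain.addMonoidHom s) _)

theorem Edge.value_lmul (x : FreeMonoid A) (e : Edge rels u v) :
    (e.lmul x).value lam s = translate (lam x) (e.value lam s) := by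
  rw [Edge.value, Edge.value, ← translate_mul, ← map_mul]
  rfl

theorem Edge.value_rmul (y : FreeMonoid A) (e : Edge rels u v) :
    (e.rmul y).value lam s = e.value lam s := rfl

theorem Edge.value_path (e : Edge rels u v) : e.path.value lam s = e.value lam s := add_zero _

theorem DPath.value_comp (p : DPath rels u v) (q : DPath rels v w) :
    (p.comp q).value lam s = p.value lam s + q.value lam s := by
  induction p with
  | nil => exact (zero_add _).symm
  | cons e p ih => simp only [DPath.cons_comp, DPath.value, ih, add_assoc]

theorem DPath.value_inv (p : DPath rels u v) : p.inv.value lam s = -p.value lam s := by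
  induction p with
  | nil => exact neg_zero.symm
  | cons e p ih =>
    rw [DPath.inv, value_comp, ih, Edge.value_path, Edge.value_inv, DPath.value, neg_add, add_comm]

theorem DPath.value_act (x y : FreeMonoid A) (p : DPath rels u v) :
    (p.act x y).value lam s = translate (lam x) (p.value lam s) := by
  induction p with
  | nil => exact (map_zero _).symm
  | cons e p ih =>
    rw [DPath.act, DPath.value, DPath.value, ih, map_add, Edge.value_rmul, Edge.value_lmul]

theorem DPath.mapDomain_value {Y : Type*} [MulAction Lamp Y] {f : X → Y}
    (hf : ∀ (x : Lamp) i, f (x • i) = x • f i) (p : DPath rels u v) :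
    Finsupp.mapDomain f (p.value lam s) = p.value lam (f ∘ s) := by
  induction p with
  | nil => exact Finsupp.mapDomain_zero
  | cons e p ih =>
    rw [DPath.value, DPath.value, Finsupp.mapDomain_add, ih, Edge.value, mapDomain_translate f hf,
      ← Finsupp.mapDomain_comp, Edge.value]

end PathValue

theorem Edge.src_eq' {A : Type*} {rels : FreeMonoid A → FreeMonoid A → Prop} {u v : FreeMonoid A}
    (e : Edge rels u v) : e.left * e.ruleSrc * e.right = u := e.src_eq

theorem Edge.tgt_eq' {A : Type*} {rels : FreeMonoid A → FreeMonoid A → Prop} {u v : FreeMonoid A}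
    (e : Edge rels u v) : e.left * e.ruleTgt * e.right = v := e.tgt_eq

section Paths

variable {A : Type*} {rels : FreeMonoid A → FreeMonoid A → Prop}

theorem nonempty_dPath {u v : FreeMonoid A} (h : PresentedMonoid.mk rels u = .mk rels v) :
    Nonempty (DPath rels u v) := by
  have h' : ConGen.Rel rels u v := PresentedMonoid.mk_eq_mk_iff.1 h
  clear h
  induction h' with
  | of u v h =>
    exact ⟨Edge.path ⟨1, (u, v), true, 1, h, by simp, by simp⟩⟩
  | refl u => exact ⟨.nil u⟩
  | symm _ ih => exact ih.map .inv
  | trans _ _ ih ih' => exact ⟨ih.some.comp ih'.some⟩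
  | @mul u v u' v' _ _ ih ih' =>
    have p := ih.some.act 1 u'
    have q := ih'.some.act v 1
    rw [one_mul, one_mul] at p
    rw [mul_one, mul_one] at q
    exact ⟨p.comp q⟩

end Paths

/-- A lift to the wreath product of the elements of the model of `M`. -/
noncomputable def modelLift : Model false → Lamp
  | .grp g => freeToLamp g
  -- Only the position is forced here, and the lamps are set to 0 by choice. The value at zero is a
  -- dummy, since words representing zero are never compared.
  | .ab α => ⟨0, α.2.toAdd⟩
  | .zero => 1

/-! ### Values of paths for an arbitrary presentation of the model of M. -/

section Presentation

variable {A : Type*} {rels : FreeMonoid A → FreeMonoid A → Prop} (ev : FreeMonoid A →* Model false)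

/-- The lift to the wreath product of a homomorphism to the model of `M`. -/
noncomputable def wordLift : FreeMonoid A →* Lamp :=
  FreeMonoid.lift fun x => modelLift (ev (.of x))

variable {ev}

/-- The complement of the group is an ideal, so all letters of `w` lie in the group, where
`modelLift` is the homomorphism `freeToLamp`. -/
theorem wordLift_grp {w : FreeMonoid A} {g : FreeGroup Bool} (h : ev w = .grp g) :
    wordLift ev w = freeToLamp g := by
  induction w using FreeMonoid.inductionOn' generalizing g with
  | one =>
    rw [map_one, Layered.one_def, Layered.grp.injEq] at h
    rw [map_one, ← h, map_one]
  | of_mul x w ih =>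
    rw [map_mul] at h
    rw [map_mul]
    cases hx : ev (.of x) <;> cases hw : ev w <;> rw [hx, hw] at h <;> try simp at h
    rw [← h, map_mul, ih hw, wordLift, FreeMonoid.lift_eval_of, hx]
    rfl

/-- Exactly one letter of `w` lies in the middle layer, because two of them would give zero. -/
theorem wordLift_pos {w : FreeMonoid A} {α} (h : ev w = .ab α) :
    (wordLift ev w).pos = α.2.toAdd := by
  induction w using FreeMonoid.inductionOn' generalizing α with
  | one => simp [Layered.one_def] at h
  | of_mul x w ih =>
    rw [map_mul] at h
    rw [map_mul, Lamp.mul_pos]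
    cases hx : ev (.of x) <;> cases hw : ev w <;> rw [hx, hw] at h <;> try simp at h
    · rw [← h, ih hw, wordLift, FreeMonoid.lift_eval_of, hx, modelLift, freeToLamp_pos]
      rfl
    · rw [← h, wordLift_grp hw, wordLift, FreeMonoid.lift_eval_of, hx, modelLift, freeToLamp_pos]
      rfl

theorem wordLift_pos_eq {u v : FreeMonoid A} (h : ev u = ev v) (hu : ev u ≠ .zero) :
    (wordLift ev u).pos = (wordLift ev v).pos := by
  cases e : ev u with
  | grp g => rw [wordLift_grp e, wordLift_grp (h.symm.trans e)]
  | ab α => rw [wordLift_pos e, wordLift_pos (h.symm.trans e)]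
  | zero => exact absurd e hu

variable (hev : ∀ l r, rels l r → ev l = ev r)

include hev

theorem Edge.ev_rule {u v : FreeMonoid A} (e : Edge rels u v) : ev e.ruleSrc = ev e.ruleTgt := by
  unfold ruleSrc ruleTgt
  split
  · exact hev _ _ e.rule_mem
  · exact (hev _ _ e.rule_mem).symm

theorem Edge.ev_eq {u v : FreeMonoid A} (e : Edge rels u v) : ev u = ev v := by
  have h := congrArg ev e.tgt_eq'
  rw [map_mul, map_mul, ← e.ev_rule hev, ← map_mul, ← map_mul, e.src_eq'] at h
  exact h

theorem DPath.ev_eq {u v : FreeMonoid A} (p : DPath rels u v) : ev u = ev v := by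
  induction p with
  | nil => rfl
  | cons e p ih => exact (e.ev_eq hev).trans ih

/-- The rule relates two words representing the same group element, so their lifts to the wreath
product coincide. -/
theorem Edge.value_of_grp {X : Type*} [MulAction Lamp X] (s : ℤ → X) {u v : FreeMonoid A}
    {g : FreeGroup Bool} (hu : ev u = .grp g) (e : Edge rels u v) :
    e.value (wordLift ev) s = 0 := by
  rw [← e.src_eq', map_mul, map_mul] at hu
  cases h₂ : ev e.ruleSrc with
  | grp g' =>
    rw [Edge.value, wordLift_grp h₂, wordLift_grp ((e.ev_rule hev).symm.trans h₂), sub_self,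
      Finsupp.mapDomain_zero, map_zero]
  | _ =>
    rw [h₂] at hu
    cases h₁ : ev e.left <;> cases h₃ : ev e.right <;> rw [h₁, h₃] at hu <;> simp at hu

theorem DPath.value_of_grp {X : Type*} [MulAction Lamp X] (s : ℤ → X) {u v : FreeMonoid A}
    {g : FreeGroup Bool} (hu : ev u = .grp g) (p : DPath rels u v) :
    p.value (wordLift ev) s = 0 := by
  induction p with
  | nil => rfl
  | cons e p ih =>
    rw [DPath.value, e.value_of_grp hev s hu, ih ((e.ev_eq hev).symm.trans hu), add_zero]

/-- Each rule preserves positions, so an edge changes the lamps of the whole word by exactly its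
value, and the sum telescopes. -/
theorem DPath.value_id {u v : FreeMonoid A} (hu : ev u ≠ .zero) (p : DPath rels u v) :
    p.value (wordLift ev) (id : ℤ → ℤ) = (wordLift ev u).lamps - (wordLift ev v).lamps := by
  induction p with
  | nil => exact (sub_self _).symm
  | @cons u v w e p ih =>
    have hr : ev e.ruleSrc ≠ .zero := by
      intro h
      rw [← e.src_eq', map_mul, map_mul, h] at hu
      simp at hu
    have hpos := wordLift_pos_eq (e.ev_rule hev) hr
    have he : e.value (wordLift ev) (id : ℤ → ℤ) =
        (wordLift ev u).lamps - (wordLift ev v).lamps := by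
      rw [Edge.value, Finsupp.mapDomain_id]
      have h₁ := congrArg (wordLift ev) e.src_eq'
      have h₂ := congrArg (wordLift ev) e.tgt_eq'
      rw [← h₁, ← h₂]
      simp only [map_mul, Lamp.mul_lamps, Lamp.mul_pos, hpos]
      change shift _ _ = _
      rw [map_sub]
      abel
    rw [DPath.value, he, ih (e.ev_eq hev ▸ hu), sub_add_sub_cancel]

/-- The critical condition is (H1), where the value of `e₂` is translated by the lift of `u₁` on one
side and of `v₁` on the other. If `u₁` represents a group element the two lifts agree; otherwise
`u₂` represents a group element and the value of `e₂` vanishes. -/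
theorem isHomotopyRelation_value {X : Type*} [MulAction Lamp X] (s : ℤ → X) :
    IsHomotopyRelation rels fun u _ p q =>
      ∀ α, ev u = .ab α → p.value (wordLift ev) s = q.value (wordLift ev) s where
  equiv u v := ⟨fun p α _ => rfl, fun h α hα => (h α hα).symm,
    fun h h' α hα => (h α hα).trans (h' α hα)⟩
  disjoint {u₁ v₁ u₂ v₂} e₁ e₂ α hα := by
    simp only [DPath.value_comp, Edge.value_path, Edge.value_lmul, Edge.value_rmul]
    rw [add_comm]
    congr 1
    rw [map_mul] at hα
    cases h₁ : ev u₁ with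
    | grp g => rw [wordLift_grp h₁, wordLift_grp ((e₁.ev_eq hev).symm.trans h₁)]
    | ab β =>
      cases h₂ : ev u₂ with
      | grp g => rw [e₂.value_of_grp hev s h₂, map_zero, map_zero]
      | _ => simp [h₁, h₂] at hα
    | zero => simp [h₁] at hα
  act {u v} p q x y h α hα := by
    rw [DPath.value_act, DPath.value_act]
    cases hu : ev u with
    | grp g => rw [p.value_of_grp hev s hu, q.value_of_grp hev s hu]
    | ab β => rw [h β hu]
    | zero => simp [hu] at hα
  comp r p q t h α hα := by
    simp only [DPath.value_comp]
    rw [h α ((r.ev_eq hev).symm.trans hα)]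
  inv p α _ := by
    rw [DPath.value_comp, DPath.value_inv, add_neg_cancel]
    rfl

/-- Parallel paths have the same value modulo translations by large boxes. -/
theorem eventually_value_eq {u v : FreeMonoid A} (hu : ev u ≠ .zero) (p q : DPath rels u v) :
    ∃ N : ℕ, ∀ n ≥ N, p.value (wordLift ev) (boxPoint n) = q.value (wordLift ev) (boxPoint n) := by
  -- The values in ℤ[ℤ] and in ℤ[`Lamp ⧸ box n`] are both images of one value in ℤ[`Lamp`].
  let s : ℤ → Lamp := fun m => ⟨0, m⟩
  have hs (r : DPath rels u v) : Finsupp.mapDomain Lamp.pos (r.value (wordLift ev) s) =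
      r.value (wordLift ev) (id : ℤ → ℤ) := r.mapDomain_value _ s fun _ _ => rfl
  have hb (n : ℕ) (r : DPath rels u v) :
      Finsupp.mapDomain ((↑) : Lamp → Lamp ⧸ Lamp.box n) (r.value (wordLift ev) s) =
        r.value (wordLift ev) (boxPoint n) := r.mapDomain_value _ s fun _ _ => rfl
  have sub {Y : Type} (f : Lamp → Y) (F F' : Lamp →₀ ℤ) :
      Finsupp.mapDomain f (F - F') = Finsupp.mapDomain f F - Finsupp.mapDomain f F' :=
    map_sub (Finsupp.mapDomain.addMonoidHom f) F F'
  obtain ⟨N, hN⟩ := eventually_mapDomain_mk_eq_zero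
    (F := p.value (wordLift ev) s - q.value (wordLift ev) s)
    (by rw [sub, hs, hs, p.value_id hev hu, q.value_id hev hu, sub_self])
  refine ⟨N, fun n hn => sub_eq_zero.1 ?_⟩
  rw [← hb, ← hb, ← sub, hN n hn]

end Presentation

/-- The equations on the ends allow an acted path to be composed with paths whose ends are bracketed
differently. -/
theorem exists_act {A : Type*} {rels : FreeMonoid A → FreeMonoid A → Prop} {X : Type*}
    [MulAction Lamp X] (lam : FreeMonoid A →* Lamp) (s : ℤ → X) {u v u' v' : FreeMonoid A}
    (x y : FreeMonoid A) (p : DPath rels u v) (hu : u' = x * u * y) (hv : v' = x * v * y) :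
    ∃ q : DPath rels u' v', q.value lam s = translate (lam x) (p.value lam s) := by
  subst hu hv
  exact ⟨p.act x y, p.value_act lam s x y⟩

theorem exists_value_ne {A : Type*} {rels : FreeMonoid A → FreeMonoid A → Prop}
    (e : PresentedMonoid rels ≃* Model false) (n : ℕ) :
    ∃ (u v : FreeMonoid A) (p q : DPath rels u v) (α : _),
      e (PresentedMonoid.mk rels u) = .ab α ∧
      p.value (wordLift (e.toMonoidHom.comp (PresentedMonoid.mk rels))) (boxPoint n) ≠
        q.value (wordLift (e.toMonoidHom.comp (PresentedMonoid.mk rels))) (boxPoint n) := by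
  by_contra! H
  set ev := e.toMonoidHom.comp (PresentedMonoid.mk rels) with hev_def
  have hev (l r) (h : rels l r) : ev l = ev r :=
    congrArg e (PresentedMonoid.mk_eq_mk_of_rel h)
  have surj (m : Model false) : ∃ w, ev w = m := by
    obtain ⟨w, hw⟩ := PresentedMonoid.surjective_mk (e.symm m)
    exact ⟨w, by simp [hev_def, hw]⟩
  have path {u v : FreeMonoid A} (h : ev u = ev v) : Nonempty (DPath rels u v) :=
    nonempty_dPath (e.injective h)
  obtain ⟨η, hη⟩ := surj (.ab 1)
  -- The word `k` stands for an element with zero exponent sums, which the middle layer does not see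
  -- but the wreath product does.
  have word (j : ℤ) : ∃ k, ev (η * k) = .ab 1 ∧ ev (k * η) = .ab 1 ∧
      wordLift ev k = lampPair j := by
    obtain ⟨g, hg, hg'⟩ := exists_freeToLamp_eq j
    obtain ⟨k, hk⟩ := surj (.grp g)
    exact ⟨k, by simp [hη, hk, hg], by simp [hη, hk, hg], by rw [wordLift_grp hk, hg']⟩
  obtain ⟨k', hk₁', hk₂', hk₃'⟩ := word 1
  obtain ⟨p'⟩ := path (hk₁'.trans hη.symm)
  have hp' : p'.value (wordLift ev) (boxPoint n) = 0 := by
    refine eq_zero_of_translate_eq fun j => ?_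
    obtain ⟨k, hk₁, hk₂, hk₃⟩ := word j
    obtain ⟨p⟩ := path (hk₂.trans hη.symm)
    obtain ⟨a, ha⟩ := exists_act (wordLift ev) (boxPoint n) k 1 p'
      (u' := k * (η * k')) (v' := k * η) (by simp) (by simp)
    obtain ⟨b, hb⟩ := exists_act (wordLift ev) (boxPoint n) 1 k' p
      (u' := k * (η * k')) (v' := η * k') (by simp [mul_assoc]) (by simp)
    -- Two ways from `k * η * k'` to `η`: absorb `k'` first or absorb `k` first. Equality of their
    -- values says that translation by `lampPair j` fixes the value of `p'`.
    have h := H _ _ (a.comp p) (b.comp p') 1 (by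
      change ev _ = _
      rw [← mul_assoc, map_mul, hk₂, ← hη, ← map_mul, hk₁', hη])
    rw [DPath.value_comp, DPath.value_comp, ha, hb, map_one, translate_one, hk₃, add_comm] at h
    exact add_left_cancel h
  have h₀ : p'.value (wordLift ev) (id : ℤ → ℤ) = 0 := by
    have := p'.mapDomain_value (wordLift ev) (boxPoint n) (boxPos_smul n)
    rw [hp', Finsupp.mapDomain_zero] at this
    exact this.symm
  -- In ℤ[ℤ] the value of `p'` is, up to sign, a shift of the lamps of `k'`, which are not zero.
  rw [p'.value_id hev (by rw [hk₁']; simp), map_mul, Lamp.mul_lamps,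
    add_sub_cancel_left] at h₀
  have h₁ := shift_injective _ (h₀.trans (map_zero _).symm)
  have h₂ := DFunLike.congr_fun h₁ 1
  rw [hk₃'] at h₂
  simp [lampPair] at h₂

instance : Finite Gen := by
  refine Set.finite_univ_iff.1
    ((Set.toFinite {Gen.a, Gen.aInv, Gen.b, Gen.bInv, Gen.h, Gen.z}).subset ?_)
  rintro (_ | _ | _ | _ | _ | _) - <;> simp

theorem not_hasFDT_of_equiv {S : Type*} [Monoid S] (e : S ≃* Model false) : ¬ HasFDT S := by
  rintro ⟨A, rels, -, -, ⟨e'⟩, C, hC, hbase⟩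
  let f := e'.symm.trans e
  set ev := f.toMonoidHom.comp (PresentedMonoid.mk rels) with hev_def
  have hev (l r) (h : rels l r) : ev l = ev r :=
    congrArg f (PresentedMonoid.mk_eq_mk_of_rel h)
  have each (c : ParallelPair rels) : ∃ N : ℕ, ∀ n ≥ N, ∀ α, ev c.src = .ab α →
      c.fst.value (wordLift ev) (boxPoint n) = c.snd.value (wordLift ev) (boxPoint n) := by
    by_cases h : ev c.src = .zero
    · exact ⟨0, fun n _ α hα => by simp [h] at hα⟩
    · obtain ⟨N, hN⟩ := eventually_value_eq hev h c.fst c.snd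
      exact ⟨N, fun n hn α _ => hN n hn⟩
  choose N hN using each
  -- One box serves all pairs of the finite base at once, while `exists_value_ne` gives a pair of
  -- parallel paths that this same box separates.
  let n := hC.toFinset.sup N
  obtain ⟨u, v, p, q, α, hα, hne⟩ := exists_value_ne f n
  exact hne (hbase p q _ (isHomotopyRelation_value hev (boxPoint n))
    (fun c hc => hN c n (Finset.le_sup (hC.mem_toFinset.2 hc))) α hα)

end MonoidRewriting

theorem mainTheorem3 :
    MonoidRewriting.Isometric
        (MonoidRewriting.cayleySemimetric (PresentedMonoid.of MonoidRewriting.MRel))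
        (MonoidRewriting.cayleySemimetric (PresentedMonoid.of MonoidRewriting.NRel)) ∧
      ¬ MonoidRewriting.HasFDT (PresentedMonoid MonoidRewriting.MRel) ∧
      ¬ MonoidRewriting.HasFiniteCompletePresentation (PresentedMonoid MonoidRewriting.MRel) ∧
      MonoidRewriting.HasFiniteCompletePresentation (PresentedMonoid MonoidRewriting.NRel) ∧
      MonoidRewriting.HasFDT (PresentedMonoid MonoidRewriting.NRel) ∧
      ¬ MonoidRewriting.IsIsometryInvariant (fun S _ => MonoidRewriting.HasFDT S) ∧
      ¬ MonoidRewriting.IsIsometryInvariant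
          (fun S _ => MonoidRewriting.HasFiniteCompletePresentation S) := by
  have iso := MonoidRewriting.isometric_M_N
  have hM := MonoidRewriting.not_hasFDT_of_equiv MonoidRewriting.equivM
  have hM' : ¬ MonoidRewriting.HasFiniteCompletePresentation
      (PresentedMonoid MonoidRewriting.MRel) := fun h => hM h.hasFDT
  have hN := MonoidRewriting.hasFiniteCompletePresentation_N
  have gens (rels) : Submonoid.closure
      (Set.range (PresentedMonoid.of (α := MonoidRewriting.Gen) rels)) = ⊤ :=
    PresentedMonoid.closure_range_of rels
  exact ⟨iso, hM, hM', hN, hN.hasFDT,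
    fun h => hM ((h _ _ _ _ _ _ (gens _) (gens _) iso).2 hN.hasFDT),
    fun h => hM' ((h _ _ _ _ _ _ (gens _) (gens _) iso).2 hN)⟩
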